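/- Let $H$ be a separable complex Hilbert space with bounded operators $\mathcal L(H)$. For a compact operator $T$ on $H$ let $\mu_1(T)\ge\mu_2(T)\ge\cdots$ be its singular values, i.e. the eigenvalues of $|T|=(T^*T)^{1/2}$ in decreasing order with multiplicity (continued by $0$ if necessary), and let $$\mathcal M_{1,\infty}=\Big\{T \text{ compact} : \|T\|_{1,\infty}:=\sup_{k\ge 1}\frac{1}{\log(1+k)}\sum_{j=1}^{k}\mu_j(T)<\infty\Big\}.$$ A positive singular trace on $\mathcal M_{1,\infty}$ is a $\|\cdot\|_{1,\infty}$-continuous linear functional $\rho:\mathcal M_{1,\infty}\to\mathbb C$ with $\rho(T)\ge 0$ for all $0\le T\in\mathcal M_{1,\infty}$, with $\rho(aT-Ta)=0$ for all $a\in\mathcal L(H)$ and $T\in\mathcal M_{1,\infty}$, and with $\rho(F)=0$ for every finite rank operator $F$. Let $(\mathcal A,H,D)$ be a spectral triple: $\mathcal A$ is a countably generated $*$-algebra of bounded operators on $H$ that contains the identity operator, and $D:\operatorname{Dom}D\to H$ is a (possibly unbounded) selfadjoint operator such that for every $a\in\mathcal A$ one has $a\operatorname{Dom}D\subset\operatorname{Dom}D$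 and $[D,a]$ is bounded on $\operatorname{Dom}D$, and such that $\langle D\rangle^{-1}:=(1+D^2)^{-1/2}$ is compact. Let $n>0$ be a real number with $\langle D\rangle^{-n}\in\mathcal M_{1,\infty}$, and let $\rho$ be a positive singular trace on $\mathcal M_{1,\infty}$ with $\rho(\langle D\rangle^{-n})>0$. Then $a\langle D\rangle^{-n}\in\mathcal M_{1,\infty}$ for all $a\in\mathcal A$, and $\Phi_\rho(a):=\rho(a\langle D\rangle^{-n})$, $a\in\mathcal A$, is a finite positive trace on $\mathcal A$: it is a linear functional $\mathcal A\to\mathbb C$, bounded for the operator norm, with $\Phi_\rho(a)\ge 0$ whenever $a\in\mathcal A$ is a positive operator, and $\Phi_\rho(ab)=\Phi_\rho(ba)$ for all $a,b\in\mathcal A$. Moreover the normalised functional $\rho(\langle D\rangle^{-n})^{-1}\Phi_\rho$ (in particular $\Phi_\rho$ itself if $\rho(\langle D\rangle^{-n})=1$) is a trace state on $\mathcal A$: it is a finite positive trace $\tau$ with $\tau(1)=1$ and $|\tau(a)|\le\|a\|$ for all $a\in\mathcal A$. -/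

import Mathlib

open scoped ComplexOrder

noncomputable section

namespace NCG

variable {H : Type*} [NormedAddCommGroup H] [InnerProductSpace ℂ H] [CompleteSpace H]

/-! ### The operators `(1 + D²)⁻¹` and `⟨D⟩⁻¹` of an unbounded selfadjoint operator -/

/-- `R` is the everywhere defined bounded inverse of `1 + D²`: for every `x`, the vector `R x` lies
in the domain of `D²` and `(1 + D²) (R x) = x`. -/
def IsOneAddSqInv (D : H →ₗ.[ℂ] H) (R : H →L[ℂ] H) : Prop :=
  ∀ x : H, ∃ h : R x ∈ D.domain, ∃ h' : D ⟨R x, h⟩ ∈ D.domain,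
    R x + D ⟨D ⟨R x, h⟩, h'⟩ = x

theorem inner_symm_of_isSelfAdjoint {D : H →ₗ.[ℂ] H} (hD : IsSelfAdjoint D) (x y : D.domain) :
    inner ℂ (D x) (y : H) = inner ℂ (x : H) (D y) := by
  have h := LinearPMap.adjoint_isFormalAdjoint hD.dense_domain
  rw [LinearPMap.isSelfAdjoint_def.mp hD] at h
  exact h x y

/-- For selfadjoint `D` the inverse of `1 + D²` exists (von Neumann). -/
theorem exists_isOneAddSqInv {D : H →ₗ.[ℂ] H} (hD : IsSelfAdjoint D) :
    ∃ R : H →L[ℂ] H, IsOneAddSqInv D R := by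
  have hDd := LinearPMap.isSelfAdjoint_def.mp hD
  let e := WithLp.prodContinuousLinearEquiv 2 ℂ H H
  let K : Submodule ℂ (WithLp 2 (H × H)) := D.graph.comap (e : WithLp 2 (H × H) →ₗ[ℂ] H × H)
  have hK : IsClosed (K : Set (WithLp 2 (H × H))) :=
    (show IsClosed (D.graph : Set (H × H)) from hD.isClosed).preimage e.continuous
  have : CompleteSpace K := hK.completeSpace_coe
  let R : H →L[ℂ] H :=
    (ContinuousLinearMap.fst ℂ H H) ∘L (e : WithLp 2 (H × H) →L[ℂ] H × H) ∘L
      K.starProjection ∘L (e.symm : H × H →L[ℂ] WithLp 2 (H × H)) ∘L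
        (ContinuousLinearMap.inl ℂ H H)
  refine ⟨R, fun x => ?_⟩
  set p : WithLp 2 (H × H) := K.starProjection (e.symm (x, 0)) with hp
  have hRx : R x = p.fst := rfl
  have hpK : p ∈ K := K.starProjection_apply_mem _
  have hpg : (p.fst, p.snd) ∈ D.graph := hpK
  obtain ⟨y, hy1, hy2⟩ := LinearPMap.mem_graph_iff D |>.mp hpg
  simp only at hy1 hy2
  have h1 : R x ∈ D.domain := by rw [hRx, ← hy1]; exact y.2
  have hDR : D ⟨R x, h1⟩ = p.snd := by
    rw [← hy2]; congr 1; exact Subtype.ext (hRx.trans hy1.symm)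
  have horth : ∀ z : D.domain, inner ℂ (x - p.fst) (z : H) = inner ℂ p.snd (D z) := by
    intro z
    have hz : (e.symm ((z : H), D z) : WithLp 2 (H × H)) ∈ K := by
      change e (e.symm ((z : H), D z)) ∈ D.graph
      rw [e.apply_symm_apply]
      exact D.mem_graph z
    have h0 := K.starProjection_inner_eq_zero (e.symm (x, 0)) _ hz
    rw [← hp, WithLp.prod_inner_apply] at h0
    have h0' : inner ℂ (x - p.fst) (z : H) + inner ℂ (0 - p.snd) (D z) = 0 := h0
    rw [zero_sub, inner_neg_left] at h0'
    linear_combination h0'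
  have h2 : p.snd ∈ (LinearPMap.adjoint D).domain :=
    LinearPMap.mem_adjoint_domain_of_exists _ ⟨_, horth⟩
  have h3 : LinearPMap.adjoint D ⟨p.snd, h2⟩ = x - p.fst :=
    LinearPMap.adjoint_apply_eq hD.dense_domain ⟨p.snd, h2⟩ horth
  have h4 : ∃ h : p.snd ∈ D.domain, D ⟨p.snd, h⟩ = x - p.fst := by
    have : ∃ h : p.snd ∈ (LinearPMap.adjoint D).domain,
      LinearPMap.adjoint D ⟨p.snd, h⟩ = x - p.fst := ⟨h2, h3⟩
    rwa [hDd] at this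
  obtain ⟨h5, h6⟩ := h4
  have h7 : D ⟨R x, h1⟩ ∈ D.domain := by rw [hDR]; exact h5
  refine ⟨h1, h7, ?_⟩
  have h8 : D ⟨D ⟨R x, h1⟩, h7⟩ = x - p.fst := by
    rw [← h6]; congr 1; exact Subtype.ext hDR
  rw [h8, hRx]; abel

/-- The inverse of `1 + D²` is unique. -/
theorem IsOneAddSqInv.unique {D : H →ₗ.[ℂ] H} (hD : IsSelfAdjoint D) {R S : H →L[ℂ] H}
    (hR : IsOneAddSqInv D R) (hS : IsOneAddSqInv D S) : R = S := by
  ext x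
  obtain ⟨a, a', ha⟩ := hR x
  obtain ⟨b, b', hb⟩ := hS x
  have hw' : D (⟨R x, a⟩ - ⟨S x, b⟩) ∈ D.domain := by
    rw [LinearPMap.map_sub]; exact D.domain.sub_mem a' b'
  have h1 : D ⟨D (⟨R x, a⟩ - ⟨S x, b⟩), hw'⟩ = -(R x - S x) := by
    have : (⟨D (⟨R x, a⟩ - ⟨S x, b⟩), hw'⟩ : D.domain)
        = ⟨D ⟨R x, a⟩, a'⟩ - ⟨D ⟨S x, b⟩, b'⟩ := Subtype.ext (LinearPMap.map_sub _ _ _)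
    rw [this, LinearPMap.map_sub]
    have := ha.trans hb.symm
    rw [eq_comm, ← sub_eq_zero] at this
    rw [← sub_eq_zero, ← neg_eq_zero, ← this]; abel
  have h2 := inner_symm_of_isSelfAdjoint hD (⟨R x, a⟩ - ⟨S x, b⟩)
    ⟨D (⟨R x, a⟩ - ⟨S x, b⟩), hw'⟩
  rw [h1] at h2
  have h3 : ((⟨R x, a⟩ - ⟨S x, b⟩ : D.domain) : H) = R x - S x := rfl
  rw [h3, inner_neg_right, inner_self_eq_norm_sq_to_K, inner_self_eq_norm_sq_to_K] at h2
  have h4 : ‖D (⟨R x, a⟩ - ⟨S x, b⟩)‖ ^ 2 = -‖R x - S x‖ ^ 2 := by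
    have := congrArg Complex.re h2
    norm_cast at this
  have h5 : ‖R x - S x‖ = 0 := by
    have := sq_nonneg ‖D (⟨R x, a⟩ - ⟨S x, b⟩)‖
    have := sq_nonneg ‖R x - S x‖
    exact pow_eq_zero_iff two_ne_zero |>.mp (by linarith)
  exact sub_eq_zero.mp (norm_eq_zero.mp h5)

/-- The bounded operator `(1 + D²)⁻¹` of a selfadjoint operator `D`. -/
def oneAddSqInv (D : H →ₗ.[ℂ] H) (hD : IsSelfAdjoint D) : H →L[ℂ] H :=
  Classical.choose (exists_isOneAddSqInv hD)

theorem oneAddSqInv_spec (D : H →ₗ.[ℂ] H) (hD : IsSelfAdjoint D) :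
    IsOneAddSqInv D (oneAddSqInv D hD) :=
  Classical.choose_spec (exists_isOneAddSqInv hD)

theorem oneAddSqInv_nonneg (D : H →ₗ.[ℂ] H) (hD : IsSelfAdjoint D) : 0 ≤ oneAddSqInv D hD := by
  rw [ContinuousLinearMap.nonneg_iff_isPositive, ContinuousLinearMap.isPositive_iff_complex]
  intro x
  obtain ⟨h, h', hx⟩ := oneAddSqInv_spec D hD x
  have key : inner ℂ (oneAddSqInv D hD x) x
      = (((‖oneAddSqInv D hD x‖ ^ 2 + ‖D ⟨oneAddSqInv D hD x, h⟩‖ ^ 2 : ℝ)) : ℂ) := by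
    have h1 := inner_symm_of_isSelfAdjoint hD ⟨oneAddSqInv D hD x, h⟩
      ⟨D ⟨oneAddSqInv D hD x, h⟩, h'⟩
    have h2 : inner ℂ (oneAddSqInv D hD x) x = inner ℂ (oneAddSqInv D hD x)
        (oneAddSqInv D hD x + D ⟨D ⟨oneAddSqInv D hD x, h⟩, h'⟩) := by rw [hx]
    rw [h2, inner_add_right, ← h1, inner_self_eq_norm_sq_to_K, inner_self_eq_norm_sq_to_K]
    push_cast
    rfl
  rw [key]
  constructor
  · rfl
  · change (0 : ℝ) ≤ ‖oneAddSqInv D hD x‖ ^ 2 + ‖D ⟨oneAddSqInv D hD x, h⟩‖ ^ 2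
    positivity

/-- The bounded positive operator `⟨D⟩⁻¹ = (1 + D²)^(-1/2)`. -/
def angleInv (D : H →ₗ.[ℂ] H) (hD : IsSelfAdjoint D) : H →L[ℂ] H :=
  CFC.sqrt (oneAddSqInv D hD)

/-! ### Spectral triples -/

variable (H) in
/-- A spectral triple `(A, H, D)`: a countably generated unital `*`-algebra `A` of bounded operators
on `H` (containing the identity operator, hence non-degenerate), and a selfadjoint, in general
unbounded, operator `D` such that every `a ∈ A` preserves the domain of `D`, the commutator
`[D, a]` is bounded on that domain, and `⟨D⟩⁻¹` is compact. -/
structure SpectralTriple where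
  A : StarSubalgebra ℂ (H →L[ℂ] H)
  D : H →ₗ.[ℂ] H
  countablyGenerated : ∃ S : Set (H →L[ℂ] H), S.Countable ∧ StarAlgebra.adjoin ℂ S = A
  isSelfAdjoint : IsSelfAdjoint D
  map_domain : ∀ a ∈ A, ∀ x ∈ D.domain, a x ∈ D.domain
  commutator_bounded : ∀ (a : H →L[ℂ] H) (ha : a ∈ A), ∃ C : ℝ, ∀ x : D.domain,
    ‖D ⟨a x, map_domain a ha x x.2⟩ - a (D x)‖ ≤ C * ‖(x : H)‖
  isCompactOperator_angleInv : IsCompactOperator (angleInv D isSelfAdjoint)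

/-- The operator `⟨D⟩⁻ⁿ = (⟨D⟩⁻¹)ⁿ`, for a real number `n > 0`, through the continuous functional
calculus. -/
def SpectralTriple.anglePow (X : SpectralTriple H) (n : ℝ) : H →L[ℂ] H :=
  angleInv X.D X.isSelfAdjoint ^ n

/-! ### Singular values and the ideal `M_{1,∞}` -/

/-- The number, counted with multiplicity, of eigenvalues of `|T| = (T* T)^(1/2)` in `(s, ∞)`,
i.e. the dimension of the span of the corresponding eigenvectors. -/
def eigenvalueCount (T : H →L[ℂ] H) (s : ℝ) : Cardinal :=
  Module.rank ℂ (⨆ r ∈ Set.Ioi s,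
    Module.End.eigenspace ((CFC.abs T : H →L[ℂ] H) : H →ₗ[ℂ] H) ((r : ℝ) : ℂ) : Submodule ℂ H)

/-- The singular values of a compact operator `T`: the sequence of the eigenvalues of `|T|` in
decreasing order and with multiplicity, numbered from `0` and continued by `0` if there are only
finitely many positive ones. Its term of index `n` is the least `s ≥ 0` such that at most `n`
eigenvalues of `|T|` exceed `s`. -/
def singularValue (T : H →L[ℂ] H) (n : ℕ) : ℝ :=
  sInf {s : ℝ | 0 ≤ s ∧ eigenvalueCount T s ≤ n}

/-- The logarithmic average of the first `k + 1` singular values; with `N = k + 1` it is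
`(1 / log (1 + N)) * (sum of the N largest singular values)`. -/
def logAverage (T : H →L[ℂ] H) (k : ℕ) : ℝ :=
  (∑ i ∈ Finset.range (k + 1), singularValue T i) / Real.log (1 + ((k + 1 : ℕ) : ℝ))

variable (H) in
/-- The ideal `M_{1,∞}(H)` of the compact operators with bounded logarithmic averages. -/
def dixmierIdeal : Set (H →L[ℂ] H) :=
  {T | IsCompactOperator T ∧ BddAbove (Set.range (logAverage T))}

/-- The norm of `M_{1,∞}(H)` (meaningful for operators in that ideal). -/
def dixmierNorm (T : H →L[ℂ] H) : ℝ := ⨆ k, logAverage T k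

/-! ### Singular traces -/

/-- A continuous positive singular trace on `M_{1,∞}(H)`: a linear functional that vanishes on
commutators with bounded operators and on finite rank operators, is nonnegative on positive
operators and is continuous for the norm of `M_{1,∞}(H)`. Only the values of `ρ` on `M_{1,∞}(H)`
matter; its values at other operators are arbitrary. -/
structure IsPositiveSingularTrace (ρ : (H →L[ℂ] H) → ℂ) : Prop where
  map_add : ∀ S ∈ dixmierIdeal H, ∀ T ∈ dixmierIdeal H, ρ (S + T) = ρ S + ρ T
  map_smul : ∀ (c : ℂ), ∀ T ∈ dixmierIdeal H, ρ (c • T) = c * ρ T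
  map_commutator : ∀ (a : H →L[ℂ] H), ∀ T ∈ dixmierIdeal H, ρ (a * T - T * a) = 0
  map_finiteRank : ∀ F : H →L[ℂ] H, FiniteDimensional ℂ (LinearMap.range (F : H →ₗ[ℂ] H)) → ρ F = 0
  nonneg : ∀ T ∈ dixmierIdeal H, 0 ≤ T → 0 ≤ ρ T
  continuous : ∃ C : ℝ, ∀ T ∈ dixmierIdeal H, ‖ρ T‖ ≤ C * dixmierNorm T

/-! ### Traces on a `*`-algebra of operators -/

/-- A finite positive trace on a `*`-algebra `A` of bounded operators: a (finite valued) linear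
functional, bounded for the operator norm, nonnegative on positive operators, with
`τ (a b) = τ (b a)`. -/
structure IsFinitePositiveTrace (A : StarSubalgebra ℂ (H →L[ℂ] H)) (τ : A → ℂ) : Prop where
  isLinearMap : IsLinearMap ℂ τ
  bounded : ∃ C : ℝ, ∀ a : A, ‖τ a‖ ≤ C * ‖(a : H →L[ℂ] H)‖
  nonneg : ∀ a : A, 0 ≤ (a : H →L[ℂ] H) → 0 ≤ τ a
  map_mul_comm : ∀ a b : A, τ (a * b) = τ (b * a)

/-- A trace state: a finite positive trace of norm one, taking the value one at the unit. -/
structure IsTraceState (A : StarSubalgebra ℂ (H →L[ℂ] H)) (τ : A → ℂ) : Prop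
    extends IsFinitePositiveTrace A τ where
  map_one : τ 1 = 1
  norm_le : ∀ a : A, ‖τ a‖ ≤ ‖(a : H →L[ℂ] H)‖

end NCG

end

/-!
For a positive singular trace `ρ` and `E = ⟨D⟩⁻ⁿ`, the ideal property of `M_{1,∞}` makes
`φ X = ρ (X E)` a bounded functional on all bounded operators. It is positive, because
`ρ (c² E) = ρ (c E c)` by cyclicity, and it vanishes on norm limits of finite rank operators. Only
`φ (a b) = φ (b a)` for `b ∈ A` needs the spectral triple: by cyclicity the difference is
`ρ (a [b, E])`, and this must vanish.

Let `G = ⟨D⟩⁻¹` and cut its spectrum at the points `q⁻ᵏ`, with `q > 1`. Since `[D, b]` is bounded,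
the entries of `b` between non-adjacent blocks decay geometrically (`norm_offDiagonal_le`, a
Sylvester equation for `b` and `G²`), so `b = b₁ + K` with `b₁` block tridiagonal and `K` a norm
convergent series of finite rank operators (`exists_band_truncation`). The correction `K` does not
contribute to `ρ (a [b, E])`. On three adjacent blocks `E` is a scalar up to a relative error that
tends to `0` as `q → 1`; hence `‖[b₁, E] y‖ ≤ ε ‖E y‖` for every vector `y`
(`norm_commutator_le_of_band`), with `ε` depending on `q`, `n` and `‖b‖` only. Such a domination
passes to singular values (`singularValue_le_of_norm_le`), so `|ρ (a [b₁, E])| ≤ C ‖a‖ ε` by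
continuity, and `ε` is arbitrary.

No Hölder inequality for singular values is needed, and `D` enters only through a bound on the form
of `[b, G²]` (`CommutatorBound`).
-/

namespace NCG

variable {H : Type*} [NormedAddCommGroup H] [InnerProductSpace ℂ H]

/-! ### Spans of eigenspaces -/

/-- The algebraic sum of the eigenspaces of `A` for the real eigenvalues in `J` (no closure is
taken). -/
def spectralSpan (A : H →L[ℂ] H) (J : Set ℝ) : Submodule ℂ H :=
  ⨆ r ∈ J, Module.End.eigenspace ((A : H →L[ℂ] H) : H →ₗ[ℂ] H) ((r : ℝ) : ℂ)

theorem mem_spectralSpan_of_apply_eq {A : H →L[ℂ] H} {J : Set ℝ} {r : ℝ} (hr : r ∈ J) {x : H}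
    (hx : A x = (r : ℂ) • x) : x ∈ spectralSpan A J :=
  Submodule.mem_iSup_of_mem r (Submodule.mem_iSup_of_mem hr (Module.End.mem_eigenspace_iff.mpr hx))

theorem spectralSpan_mono (A : H →L[ℂ] H) {J K : Set ℝ} (h : J ⊆ K) :
    spectralSpan A J ≤ spectralSpan A K :=
  biSup_mono h

theorem spectralSpan_union (A : H →L[ℂ] H) (J K : Set ℝ) :
    spectralSpan A (J ∪ K) = spectralSpan A J ⊔ spectralSpan A K :=
  iSup_union

theorem spectralSpan_le {A : H →L[ℂ] H} {J : Set ℝ} {V : Submodule ℂ H}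
    (h : ∀ r ∈ J, ∀ x, A x = (r : ℂ) • x → x ∈ V) : spectralSpan A J ≤ V :=
  iSup₂_le fun r hr x hx => h r hr x (Module.End.mem_eigenspace_iff.mp hx)

theorem mem_spectralSpan_iff {A : H →L[ℂ] H} {J : Set ℝ} {x : H} :
    x ∈ spectralSpan A J ↔ ∃ (s : Finset ℝ) (f : ℝ → H), (∀ r ∈ s, r ∈ J) ∧
      (∀ r ∈ s, A (f r) = (r : ℂ) • f r) ∧ ∑ r ∈ s, f r = x := by
  constructor
  · intro hx
    obtain ⟨f, hf, rfl⟩ := (Submodule.mem_iSup_iff_exists_finsupp _ _).mp hx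
    have key : ∀ r ∈ f.support, r ∈ J ∧ A (f r) = (r : ℂ) • f r := by
      intro r hr
      have h := hf r
      by_cases hJ : r ∈ J
      · refine ⟨hJ, ?_⟩
        simpa [hJ, Module.End.mem_eigenspace_iff] using h
      · exact absurd (by simpa [hJ] using h) (Finsupp.mem_support_iff.mp hr)
    exact ⟨f.support, f, fun r hr => (key r hr).1, fun r hr => (key r hr).2, rfl⟩
  · rintro ⟨s, f, hJ, hf, rfl⟩
    exact Submodule.sum_mem _ fun r hr => mem_spectralSpan_of_apply_eq (hJ r hr) (hf r hr)

theorem norm_sum_sq_of_pairwise_inner_eq_zero {ι : Type*} (s : Finset ι) (f : ι → H)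
    (h : ∀ i ∈ s, ∀ j ∈ s, i ≠ j → inner ℂ (f i) (f j) = 0) :
    ‖∑ i ∈ s, f i‖ ^ 2 = ∑ i ∈ s, ‖f i‖ ^ 2 := by
  classical
  induction s using Finset.induction_on with
  | empty => simp
  | insert a s ha ih =>
    rw [Finset.sum_insert ha, Finset.sum_insert ha,
      ← ih fun i hi j hj => h i (Finset.mem_insert_of_mem hi) j (Finset.mem_insert_of_mem hj)]
    have h0 : inner ℂ (f a) (∑ i ∈ s, f i) = 0 := by
      rw [inner_sum]
      exact Finset.sum_eq_zero fun i hi => h a (Finset.mem_insert_self a s) i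
        (Finset.mem_insert_of_mem hi) (by rintro rfl; exact ha hi)
    have := norm_add_sq_eq_norm_sq_add_norm_sq_of_inner_eq_zero _ _ h0
    linarith

theorem inner_eq_zero_of_apply_eq {A : H →L[ℂ] H}
    (hA : (A : H →ₗ[ℂ] H).IsSymmetric) {r t : ℝ} (hrt : r ≠ t) {x y : H}
    (hx : A x = (r : ℂ) • x) (hy : A y = (t : ℂ) • y) : inner ℂ x y = 0 := by
  have h := hA x y
  simp only [ContinuousLinearMap.coe_coe] at h
  rw [hx, hy, inner_smul_left, inner_smul_right, Complex.conj_ofReal] at h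
  have : ((r : ℂ) - t) * inner ℂ x y = 0 := by linear_combination h
  exact (mul_eq_zero.mp this).resolve_left
    (sub_ne_zero.mpr (Complex.ofReal_injective.ne hrt))

theorem spectralSpan_isOrtho {A : H →L[ℂ] H} (hA : (A : H →ₗ[ℂ] H).IsSymmetric) {J K : Set ℝ}
    (h : Disjoint J K) : spectralSpan A J ⟂ spectralSpan A K := by
  rw [Submodule.isOrtho_iff_inner_eq]
  intro x hx y hy
  obtain ⟨s, f, hs, hf, rfl⟩ := mem_spectralSpan_iff.mp hx
  obtain ⟨t, g, ht, hg, rfl⟩ := mem_spectralSpan_iff.mp hy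
  rw [sum_inner]
  refine Finset.sum_eq_zero fun i hi => ?_
  rw [inner_sum]
  refine Finset.sum_eq_zero fun j hj => ?_
  refine inner_eq_zero_of_apply_eq hA ?_ (hf i hi) (hg j hj)
  rintro rfl
  exact Set.disjoint_left.mp h (hs i hi) (ht i hj)

/-- A finite sum of eigenvectors of `A`, together with its image under an operator `B` that acts on
the eigenvectors of `A` as a function `g` of the eigenvalue: both norms are given by Pythagoras. -/
theorem exists_norm_sq_eq_of_mem_spectralSpan {A B : H →L[ℂ] H}
    (hA : (A : H →ₗ[ℂ] H).IsSymmetric) {J : Set ℝ} {g : ℝ → ℂ}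
    (hB : ∀ r ∈ J, ∀ x, A x = (r : ℂ) • x → B x = g r • x) {x : H} (hx : x ∈ spectralSpan A J) :
    ∃ (s : Finset ℝ) (f : ℝ → H), (∀ r ∈ s, r ∈ J) ∧ ‖x‖ ^ 2 = ∑ r ∈ s, ‖f r‖ ^ 2 ∧
      ‖B x‖ ^ 2 = ∑ r ∈ s, (‖g r‖ * ‖f r‖) ^ 2 := by
  obtain ⟨s, f, hs, hf, rfl⟩ := mem_spectralSpan_iff.mp hx
  have hort : ∀ i ∈ s, ∀ j ∈ s, i ≠ j → inner ℂ (f i) (f j) = 0 := fun i hi j hj hij =>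
    inner_eq_zero_of_apply_eq hA hij (hf i hi) (hf j hj)
  refine ⟨s, f, hs, norm_sum_sq_of_pairwise_inner_eq_zero s f hort, ?_⟩
  rw [map_sum, norm_sum_sq_of_pairwise_inner_eq_zero]
  · refine Finset.sum_congr rfl fun r hr => ?_
    rw [hB r (hs r hr) _ (hf r hr), norm_smul]
  · intro i hi j hj hij
    rw [hB i (hs i hi) _ (hf i hi), hB j (hs j hj) _ (hf j hj), inner_smul_left, inner_smul_right,
      hort i hi j hj hij, mul_zero, mul_zero]

theorem norm_apply_le_of_mem_spectralSpan {A B : H →L[ℂ] H}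
    (hA : (A : H →ₗ[ℂ] H).IsSymmetric) {J : Set ℝ} {g : ℝ → ℂ}
    (hB : ∀ r ∈ J, ∀ x, A x = (r : ℂ) • x → B x = g r • x) {c : ℝ} (hc : 0 ≤ c)
    (hg : ∀ r ∈ J, ‖g r‖ ≤ c) {x : H} (hx : x ∈ spectralSpan A J) : ‖B x‖ ≤ c * ‖x‖ := by
  obtain ⟨s, f, hs, h1, h2⟩ := exists_norm_sq_eq_of_mem_spectralSpan hA hB hx
  refine le_of_sq_le_sq ?_ (by positivity)
  rw [mul_pow, h1, h2, Finset.mul_sum]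
  refine Finset.sum_le_sum fun r hr => ?_
  rw [mul_pow]
  gcongr
  exact hg r (hs r hr)

theorem le_norm_apply_of_mem_spectralSpan {A B : H →L[ℂ] H}
    (hA : (A : H →ₗ[ℂ] H).IsSymmetric) {J : Set ℝ} {g : ℝ → ℂ}
    (hB : ∀ r ∈ J, ∀ x, A x = (r : ℂ) • x → B x = g r • x) {c : ℝ} (hc : 0 ≤ c)
    (hg : ∀ r ∈ J, c ≤ ‖g r‖) {x : H} (hx : x ∈ spectralSpan A J) : c * ‖x‖ ≤ ‖B x‖ := by
  obtain ⟨s, f, hs, h1, h2⟩ := exists_norm_sq_eq_of_mem_spectralSpan hA hB hx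
  refine le_of_sq_le_sq ?_ (by positivity)
  rw [mul_pow, h1, h2, Finset.mul_sum]
  refine Finset.sum_le_sum fun r hr => ?_
  rw [mul_pow]
  gcongr
  exact hg r (hs r hr)

theorem norm_apply_le_of_mem_topologicalClosure {V : Submodule ℂ H} {B C : H →L[ℂ] H} {c : ℝ}
    (h : ∀ x ∈ V, ‖B x‖ ≤ c * ‖C x‖) {x : H} (hx : x ∈ V.topologicalClosure) :
    ‖B x‖ ≤ c * ‖C x‖ := by
  have hcl : IsClosed {x : H | ‖B x‖ ≤ c * ‖C x‖} :=
    isClosed_le (by fun_prop) (by fun_prop)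
  exact closure_minimal (s := (V : Set H)) (fun y hy => h y hy) hcl hx

theorem nonneg_of_apply_eq {A : H →L[ℂ] H} (hA : 0 ≤ A) {r : ℝ} {x : H} (hx0 : x ≠ 0)
    (hx : A x = (r : ℂ) • x) : 0 ≤ r := by
  have h := ((ContinuousLinearMap.nonneg_iff_isPositive _).mp hA).inner_nonneg_right x
  rw [hx, inner_smul_right, inner_self_eq_norm_sq_to_K] at h
  have h' : (0 : ℂ) ≤ ((r * ‖x‖ ^ 2 : ℝ) : ℂ) := by push_cast; exact h
  have := Complex.zero_le_real.mp h'
  have hx' : 0 < ‖x‖ ^ 2 := by positivity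
  exact nonneg_of_mul_nonneg_left this hx'

variable [CompleteSpace H]

theorem isSymmetric_of_nonneg {A : H →L[ℂ] H} (hA : 0 ≤ A) : (A : H →ₗ[ℂ] H).IsSymmetric :=
  (IsSelfAdjoint.of_nonneg hA).isSymmetric

/-- The spectral theorem for a positive compact operator. -/
theorem orthogonal_spectralSpan_Ici_eq_bot {A : H →L[ℂ] H} (hA : 0 ≤ A) (hc : IsCompactOperator A) :
    (spectralSpan A (Set.Ici 0))ᗮ = ⊥ := by
  rw [eq_bot_iff, ← ContinuousLinearMap.orthogonalComplement_iSup_eigenspaces_eq_bot hc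
    (isSymmetric_of_nonneg hA)]
  refine Submodule.orthogonal_le (iSup_le fun μ x hx => ?_)
  rw [Module.End.mem_eigenspace_iff] at hx
  by_cases hx0 : x = 0
  · rw [hx0]; exact Submodule.zero_mem _
  have hev : Module.End.HasEigenvalue (A : H →ₗ[ℂ] H) μ :=
    Module.End.hasEigenvalue_of_hasEigenvector (x := x) ⟨Module.End.mem_eigenspace_iff.mpr hx, hx0⟩
  have hμ := (isSymmetric_of_nonneg hA).conj_eigenvalue_eq_self hev
  have hμ' : ((μ.re : ℝ) : ℂ) = μ := Complex.conj_eq_iff_re.mp hμ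
  have hx' : A x = ((μ.re : ℝ) : ℂ) • x := by rw [hμ']; exact hx
  exact mem_spectralSpan_of_apply_eq (nonneg_of_apply_eq hA hx0 hx') hx'

/-- The orthogonal complement of the eigenvectors with large eigenvalue is generated by the
eigenvectors with small eigenvalue. -/
theorem orthogonal_spectralSpan_Ioi_le {A : H →L[ℂ] H} (hA : 0 ≤ A) (hc : IsCompactOperator A)
    {s : ℝ} (hs : 0 ≤ s) :
    (spectralSpan A (Set.Ioi s))ᗮ ≤ (spectralSpan A (Set.Icc 0 s)).topologicalClosure := by
  set U := spectralSpan A (Set.Icc 0 s) with hU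
  set V := spectralSpan A (Set.Ioi s) with hV
  have hUV : U ≤ Vᗮ := by
    refine (spectralSpan_isOrtho (isSymmetric_of_nonneg hA) ?_).le
    exact Set.disjoint_left.mpr fun r hr hr' => not_lt.mpr hr.2 hr'
  have hUV' : U.topologicalClosure ≤ Vᗮ :=
    Submodule.topologicalClosure_minimal _ hUV (Submodule.isClosed_orthogonal V)
  have : CompleteSpace U.topologicalClosure :=
    (Submodule.isClosed_topologicalClosure U).completeSpace_coe
  intro y hy
  have h1 : y - U.topologicalClosure.starProjection y ∈ U.topologicalClosureᗮ :=
    Submodule.sub_starProjection_mem_orthogonal y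
  have h2 : y - U.topologicalClosure.starProjection y ∈ Vᗮ :=
    Submodule.sub_mem _ hy (hUV' (Submodule.starProjection_apply_mem _ _))
  have h3 : y - U.topologicalClosure.starProjection y ∈ (spectralSpan A (Set.Ici 0))ᗮ := by
    have : Set.Ici (0 : ℝ) = Set.Icc 0 s ∪ Set.Ioi s := by
      rw [Set.Icc_union_Ioi_eq_Ici hs]
    rw [this, spectralSpan_union, ← Submodule.inf_orthogonal]
    exact ⟨Submodule.orthogonal_le (Submodule.le_topologicalClosure U) h1, h2⟩
  rw [orthogonal_spectralSpan_Ici_eq_bot hA hc, Submodule.mem_bot, sub_eq_zero] at h3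
  rw [h3]
  exact Submodule.starProjection_apply_mem _ _

/-- A vector of the span for `(s, ∞)` that is orthogonal to the span for `(t, ∞)` is a sum of
eigenvectors for `(s, t]`. -/
theorem mem_spectralSpan_Ioc {A : H →L[ℂ] H} (hA : 0 ≤ A) {s t : ℝ} (hst : s ≤ t) {x : H}
    (hx : x ∈ spectralSpan A (Set.Ioi s)) (hx' : x ∈ (spectralSpan A (Set.Ioi t))ᗮ) :
    x ∈ spectralSpan A (Set.Ioc s t) := by
  rw [← Set.Ioc_union_Ioi_eq_Ioi hst, spectralSpan_union] at hx
  obtain ⟨v, hv, u, hu, rfl⟩ := Submodule.mem_sup.mp hx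
  have hort : v ∈ (spectralSpan A (Set.Ioi t))ᗮ := by
    refine (spectralSpan_isOrtho (isSymmetric_of_nonneg hA) ?_).le hv
    exact Set.disjoint_left.mpr fun r hr hr' => not_lt.mpr hr.2 hr'
  have hu' : u ∈ (spectralSpan A (Set.Ioi t))ᗮ := by
    have := Submodule.sub_mem _ hx' hort
    rwa [add_sub_cancel_left] at this
  have hu0 : u = 0 := by
    have := Submodule.inner_right_of_mem_orthogonal hu hu'
    exact inner_self_eq_zero.mp this
  rw [hu0, add_zero]
  exact hv

theorem norm_apply_le_of_mem_orthogonal_spectralSpan {A : H →L[ℂ] H} (hA : 0 ≤ A)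
    (hc : IsCompactOperator A) {s : ℝ} (hs : 0 ≤ s) {x : H}
    (hx : x ∈ (spectralSpan A (Set.Ioi s))ᗮ) : ‖A x‖ ≤ s * ‖x‖ := by
  refine norm_apply_le_of_mem_topologicalClosure (C := ContinuousLinearMap.id ℂ H) ?_
    (orthogonal_spectralSpan_Ioi_le hA hc hs hx)
  intro y hy
  refine norm_apply_le_of_mem_spectralSpan (isSymmetric_of_nonneg hA) (g := fun r => (r : ℂ))
    (fun r _ x hx => hx) hs (fun r hr => ?_) hy
  rw [Complex.norm_real, Real.norm_eq_abs, abs_of_nonneg hr.1]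
  exact hr.2

theorem le_norm_apply_of_mem_spectralSpan_Ioi {A : H →L[ℂ] H} (hA : 0 ≤ A)
    {s : ℝ} (hs : 0 ≤ s) {x : H} (hx : x ∈ spectralSpan A (Set.Ioi s)) : s * ‖x‖ ≤ ‖A x‖ := by
  refine le_norm_apply_of_mem_spectralSpan (isSymmetric_of_nonneg hA) (g := fun r => (r : ℂ))
    (fun r _ x hx => hx) hs (fun r hr => ?_) hx
  rw [Complex.norm_real]
  exact (le_of_lt hr).trans (le_abs_self r)

/-- An infinite-dimensional space on which a compact operator is bounded below would contain a
bounded separated sequence whose image has no convergent subsequence. -/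
theorem finiteDimensional_spectralSpan_Ioi {A : H →L[ℂ] H} (hA : 0 ≤ A)
    (hc : IsCompactOperator A) {s : ℝ} (hs : 0 < s) :
    FiniteDimensional ℂ (spectralSpan A (Set.Ioi s)) := by
  by_contra hfd
  obtain ⟨R, f, hR, hf, hsep⟩ := exists_seq_norm_le_one_le_norm_sub (𝕜 := ℂ) hfd
  have hK : IsCompact (closure (A '' Metric.closedBall 0 R)) :=
    hc.isCompact_closure_image_closedBall (f := (A : H →ₗ[ℂ] H)) R
  obtain ⟨z, -, φ, hφ, hlim⟩ := hK.tendsto_subseq (x := fun n => A (f n)) fun n =>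
    subset_closure ⟨f n, by simpa using hf n, rfl⟩
  have hcau := hlim.cauchySeq
  obtain ⟨N, hN⟩ := Metric.cauchySeq_iff.mp hcau s hs
  have h1 := hN N le_rfl (N + 1) (Nat.le_succ N)
  have h2 := hsep (hφ (Nat.lt_succ_self N)).ne
  have h3 := le_norm_apply_of_mem_spectralSpan_Ioi hA hs.le (f (φ N) - f (φ (N + 1))).2
  rw [dist_eq_norm] at h1
  simp only [Function.comp_apply, ← map_sub] at h1
  have h4 : s * 1 ≤ s * ‖f (φ N) - f (φ (N + 1))‖ := by gcongr
  rw [Submodule.coe_norm] at h4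
  push_cast at h3 h4
  linarith

theorem cfcHom_apply_of_apply_eq {A : H →L[ℂ] H} (hA : IsSelfAdjoint A) {r : ℝ}
    (hr : r ∈ spectrum ℝ A) {x : H} (hx : A x = (r : ℂ) • x) (g : C(spectrum ℝ A, ℝ)) :
    cfcHom hA g x = ((g ⟨r, hr⟩ : ℝ) : ℂ) • x := by
  induction g using ContinuousMap.induction_on_of_compact with
  | const t =>
    have : ContinuousMap.const (spectrum ℝ A) t = algebraMap ℝ C(spectrum ℝ A, ℝ) t := rfl
    rw [this, AlgHomClass.commutes, Algebra.algebraMap_eq_smul_one]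
    simp
  | id => rw [cfcHom_id]; exact hx
  | star_id => rw [map_star, cfcHom_id, hA.star_eq]; exact hx
  | add f g hf hg => rw [map_add, add_apply, hf, hg]; simp [add_smul]
  | mul f g hf hg =>
    rw [map_mul, mul_apply_eq_comp, hg, map_smul, hf, smul_smul]
    simp [mul_comm]
  | frequently f hf =>
    have hcl : IsClosed {g : C(spectrum ℝ A, ℝ) | cfcHom hA g x = ((g ⟨r, hr⟩ : ℝ) : ℂ) • x} := by
      refine isClosed_eq ?_ ?_
      · exact (ContinuousLinearMap.apply ℂ H x).continuous.comp (cfcHom_continuous hA)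
      · exact (Complex.continuous_ofReal.comp (continuous_eval_const _)).smul
          continuous_const
    exact hcl.mem_of_frequently_of_tendsto hf Filter.tendsto_id

/-- A real power of a positive operator acts on an eigenvector as the power of the eigenvalue. -/
theorem rpow_apply_of_apply_eq {A : H →L[ℂ] H} (hA : 0 ≤ A) {n : ℝ} (hn : 0 < n) {r : ℝ}
    (hr : 0 ≤ r) {x : H} (hx : A x = (r : ℂ) • x) : (A ^ n) x = ((r ^ n : ℝ) : ℂ) • x := by
  by_cases hx0 : x = 0
  · simp [hx0]
  have hsp : r ∈ spectrum ℝ A := by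
    rw [← spectrum.algebraMap_mem_iff ℂ, ContinuousLinearMap.spectrum_eq]
    refine Module.End.HasEigenvalue.mem_spectrum (Module.End.hasEigenvalue_of_hasEigenvector
      (x := x) ⟨Module.End.mem_eigenspace_iff.mpr hx, hx0⟩)
  have hsa : IsSelfAdjoint A := .of_nonneg hA
  have hcont : ContinuousOn (fun x : ℝ => (((x.toNNReal) ^ n : NNReal) : ℝ)) (spectrum ℝ A) := by
    refine Continuous.continuousOn ?_
    exact NNReal.continuous_coe.comp
      ((NNReal.continuous_rpow_const hn.le).comp continuous_real_toNNReal)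
  rw [CFC.rpow_def, cfc_nnreal_eq_real _ A hA, cfc_apply _ A hsa hcont,
    cfcHom_apply_of_apply_eq hsa hsp hx]
  simp [max_eq_left hr]

end NCG

namespace NCG

variable {H : Type*} [NormedAddCommGroup H] [InnerProductSpace ℂ H]

/-! ### Singular values under domination -/

/-- Compactness passes to every operator dominated in norm, vector by vector. -/
theorem isCompactOperator_of_norm_le {T W : H →L[ℂ] H} [CompleteSpace H]
    (hT : IsCompactOperator T) {c : ℝ}
    (h : ∀ y, ‖W y‖ ≤ c * ‖T y‖) : IsCompactOperator W := by
  have hK : IsCompact (closure (T '' Metric.closedBall 0 1)) :=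
    hT.isCompact_closure_image_closedBall (f := (T : H →ₗ[ℂ] H)) 1
  have htb : TotallyBounded (T '' Metric.closedBall 0 1) :=
    hK.totallyBounded.subset subset_closure
  have htb' : TotallyBounded (W '' Metric.closedBall 0 1) := by
    rw [Metric.totallyBounded_iff]
    intro ε hε
    obtain ⟨t, hts, htf, hcov⟩ := totallyBounded_iff_subset.mp htb
      {p | dist p.1 p.2 < ε / (|c| + 1)} (Metric.dist_mem_uniformity (by positivity))
    choose! σ hσ hσT using fun z (hz : z ∈ t) => hts hz
    refine ⟨(fun z => W (σ z)) '' t, htf.image _, ?_⟩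
    rintro _ ⟨y, hy, rfl⟩
    obtain ⟨z, hz, hyz⟩ := Set.mem_iUnion₂.mp (hcov ⟨y, hy, rfl⟩)
    refine Set.mem_iUnion₂.mpr ⟨_, ⟨z, hz, rfl⟩, ?_⟩
    rw [Metric.mem_ball, dist_eq_norm, ← map_sub]
    have h1 : ‖T (y - σ z)‖ < ε / (|c| + 1) := by
      rw [map_sub, hσT z hz, ← dist_eq_norm]; exact hyz
    calc ‖W (y - σ z)‖ ≤ c * ‖T (y - σ z)‖ := h _
      _ ≤ (|c| + 1) * ‖T (y - σ z)‖ := by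
        gcongr; exact (le_abs_self c).trans (by linarith)
      _ < (|c| + 1) * (ε / (|c| + 1)) := by gcongr
      _ = ε := by field_simp
  refine (isCompactOperator_iff_isCompact_closure_image_closedBall (W : H →ₗ[ℂ] H)
    one_pos).mpr ?_
  exact htb'.closure.isCompact_of_isClosed isClosed_closure

theorem finiteDimensional_of_rank_le {V : Submodule ℂ H} {n : ℕ} (h : Module.rank ℂ V ≤ n) :
    FiniteDimensional ℂ V :=
  Module.rank_lt_aleph0_iff.mp (h.trans_lt (Cardinal.natCast_lt_aleph0))

theorem norm_mul_apply_le (a T : H →L[ℂ] H) (y : H) : ‖(a * T) y‖ ≤ ‖a‖ * ‖T y‖ :=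
  a.le_opNorm (T y)

variable [CompleteSpace H]

theorem norm_abs_apply (T : H →L[ℂ] H) (x : H) : ‖(CFC.abs T : H →L[ℂ] H) x‖ = ‖T x‖ := by
  have h : inner ℂ ((CFC.abs T : H →L[ℂ] H) x) ((CFC.abs T : H →L[ℂ] H) x) =
      inner ℂ (T x) (T x) := by
    have hs : IsSelfAdjoint (CFC.abs T) := .of_nonneg (CFC.abs_nonneg T)
    rw [← ContinuousLinearMap.adjoint_inner_right, ← ContinuousLinearMap.star_eq_adjoint,
      hs.star_eq, ← mul_apply_eq_comp, CFC.abs_mul_abs, mul_apply_eq_comp,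
      ContinuousLinearMap.star_eq_adjoint, ContinuousLinearMap.adjoint_inner_right]
  rw [inner_self_eq_norm_sq_to_K, inner_self_eq_norm_sq_to_K] at h
  have h' : ‖CFC.abs T x‖ ^ 2 = ‖T x‖ ^ 2 := by exact_mod_cast h
  exact (sq_eq_sq₀ (norm_nonneg _) (norm_nonneg _)).mp h'

theorem eigenvalueCount_eq_rank (T : H →L[ℂ] H) (s : ℝ) :
    eigenvalueCount T s = Module.rank ℂ (spectralSpan (CFC.abs T) (Set.Ioi s)) := rfl

theorem isCompactOperator_abs {T : H →L[ℂ] H} (hT : IsCompactOperator T) :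
    IsCompactOperator (CFC.abs T : H →L[ℂ] H) :=
  isCompactOperator_of_norm_le (c := 1) hT fun y => by rw [norm_abs_apply, one_mul]

theorem norm_apply_le_of_mem_orthogonal_abs {T : H →L[ℂ] H} (hT : IsCompactOperator T) {s : ℝ}
    (hs : 0 ≤ s) {y : H} (hy : y ∈ (spectralSpan (CFC.abs T) (Set.Ioi s))ᗮ) :
    ‖T y‖ ≤ s * ‖y‖ := by
  rw [← norm_abs_apply]
  exact norm_apply_le_of_mem_orthogonal_spectralSpan (CFC.abs_nonneg T)
    (isCompactOperator_abs hT) hs hy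

theorem lt_norm_apply_of_mem_spectralSpan_Ioi {A : H →L[ℂ] H} (hA : 0 ≤ A)
    {s : ℝ} (hs : 0 ≤ s) {x : H} (hx : x ∈ spectralSpan A (Set.Ioi s)) (hx0 : x ≠ 0) :
    s * ‖x‖ < ‖A x‖ := by
  obtain ⟨t, f, ht, h1, h2⟩ := exists_norm_sq_eq_of_mem_spectralSpan (B := A)
    (isSymmetric_of_nonneg hA) (g := fun r => (r : ℂ)) (fun r _ x hx => hx) hx
  refine lt_of_pow_lt_pow_left₀ 2 (norm_nonneg _) ?_
  rw [mul_pow, h1, h2, Finset.mul_sum]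
  have hle : ∀ r ∈ t, s ^ 2 * ‖f r‖ ^ 2 ≤ (‖(r : ℂ)‖ * ‖f r‖) ^ 2 := by
    intro r hr
    rw [mul_pow, Complex.norm_real, Real.norm_eq_abs, sq_abs]
    have : s < r := ht r hr
    gcongr
  refine Finset.sum_lt_sum hle ?_
  have hpos : 0 < ∑ r ∈ t, ‖f r‖ ^ 2 := by rw [← h1]; positivity
  obtain ⟨r, hr, hfr⟩ := Finset.exists_ne_zero_of_sum_ne_zero hpos.ne'
  refine ⟨r, hr, ?_⟩
  rw [mul_pow, Complex.norm_real, Real.norm_eq_abs, sq_abs]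
  have : s < r := ht r hr
  have h3 : 0 < ‖f r‖ ^ 2 := lt_of_le_of_ne (by positivity) (Ne.symm hfr)
  gcongr

/-- If `T` is bounded by `s` on a subspace of codimension at most `n`, then at most `n` eigenvalues
of `|T|` exceed `s`. -/
theorem eigenvalueCount_le {T : H →L[ℂ] H} {s : ℝ} (hs : 0 ≤ s) {V : Submodule ℂ H}
    [FiniteDimensional ℂ V] (h : ∀ y ∈ Vᗮ, ‖T y‖ ≤ s * ‖y‖) :
    eigenvalueCount T s ≤ Module.rank ℂ V := by
  rw [eigenvalueCount_eq_rank]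
  set U := spectralSpan (CFC.abs T) (Set.Ioi s)
  let p : U →ₗ[ℂ] V := (V.orthogonalProjectionOnto : H →ₗ[ℂ] V) ∘ₗ U.subtype
  refine LinearMap.rank_le_of_injective p ?_
  rw [← LinearMap.ker_eq_bot, LinearMap.ker_eq_bot']
  intro x hx
  by_contra hx0
  have hx' : (x : H) ∈ Vᗮ := Submodule.orthogonalProjectionOnto_eq_zero_iff.mp hx
  have h1 := lt_norm_apply_of_mem_spectralSpan_Ioi (CFC.abs_nonneg T) hs x.2
    (by simpa using hx0)
  rw [norm_abs_apply] at h1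
  exact absurd (h x hx') (not_le.mpr h1)

theorem singularValue_nonneg (T : H →L[ℂ] H) (n : ℕ) : 0 ≤ singularValue T n :=
  Real.sInf_nonneg fun _ hs => hs.1

theorem singularValue_le {T : H →L[ℂ] H} {n : ℕ} {s : ℝ} (hs : 0 ≤ s)
    (h : eigenvalueCount T s ≤ n) : singularValue T n ≤ s :=
  csInf_le ⟨0, fun _ ht => ht.1⟩ ⟨hs, h⟩

/-- This guards against the junk value `sInf ∅ = 0` in the definition of `singularValue`. -/
theorem singularValue_set_nonempty (T : H →L[ℂ] H) (n : ℕ) :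
    {s : ℝ | 0 ≤ s ∧ eigenvalueCount T s ≤ n}.Nonempty := by
  refine ⟨‖T‖, norm_nonneg T, ?_⟩
  refine (eigenvalueCount_le (V := ⊥) (norm_nonneg T) fun y _ => T.le_opNorm y).trans ?_
  simp

/-- Comparison of singular values: every subspace that witnesses a bound for `μₙ(T)` yields a
subspace of no larger dimension that witnesses the bound for `μₙ(W)`. -/
theorem singularValue_le_mul_of_forall {T W : H →L[ℂ] H} {c : ℝ} (hc : 0 ≤ c) (n : ℕ)
    (h : ∀ s, 0 ≤ s → eigenvalueCount T s ≤ n → eigenvalueCount W (c * s) ≤ n) :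
    singularValue W n ≤ c * singularValue T n := by
  have hn := singularValue_set_nonempty T n
  rw [singularValue, singularValue, ← smul_eq_mul, ← Real.sInf_smul_of_nonneg hc]
  refine le_csInf (hn.smul_set) ?_
  rintro _ ⟨s, hs, rfl⟩
  exact singularValue_le (mul_nonneg hc hs.1) (h s hs.1 hs.2)

theorem singularValue_le_of_norm_le {T W : H →L[ℂ] H} (hT : IsCompactOperator T) {c : ℝ}
    (hc : 0 ≤ c) (h : ∀ y, ‖W y‖ ≤ c * ‖T y‖) (n : ℕ) :
    singularValue W n ≤ c * singularValue T n := by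
  refine singularValue_le_mul_of_forall hc n fun s hs hcount => ?_
  have : FiniteDimensional ℂ (spectralSpan (CFC.abs T : H →L[ℂ] H) (Set.Ioi s)) :=
    finiteDimensional_of_rank_le hcount
  refine (eigenvalueCount_le (mul_nonneg hc hs)
    (V := spectralSpan (CFC.abs T) (Set.Ioi s)) fun y hy => ?_).trans hcount
  calc ‖W y‖ ≤ c * ‖T y‖ := h y
    _ ≤ c * (s * ‖y‖) := by
      gcongr; exact norm_apply_le_of_mem_orthogonal_abs hT hs hy
    _ = c * s * ‖y‖ := by ring

theorem singularValue_mul_right_le {T : H →L[ℂ] H} (hT : IsCompactOperator T) (a : H →L[ℂ] H)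
    (n : ℕ) : singularValue (T * a) n ≤ ‖a‖ * singularValue T n := by
  refine singularValue_le_mul_of_forall (norm_nonneg a) n fun s hs hcount => ?_
  set V := spectralSpan (CFC.abs T) (Set.Ioi s)
  have : FiniteDimensional ℂ V := finiteDimensional_of_rank_le hcount
  refine (eigenvalueCount_le (mul_nonneg (norm_nonneg a) hs)
    (V := V.map ((ContinuousLinearMap.adjoint a : H →L[ℂ] H) : H →ₗ[ℂ] H)) fun y hy => ?_).trans
      ((rank_map_le _ _).trans hcount)
  have hay : a y ∈ Vᗮ := by
    intro v hv
    rw [← ContinuousLinearMap.adjoint_inner_left]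
    exact hy _ ⟨v, hv, rfl⟩
  calc ‖T (a y)‖ ≤ s * ‖a y‖ := norm_apply_le_of_mem_orthogonal_abs hT hs hay
    _ ≤ s * (‖a‖ * ‖y‖) := by gcongr; exact a.le_opNorm y
    _ = ‖a‖ * s * ‖y‖ := by ring

/-! ### The ideal property of `M_{1,∞}` -/

theorem logAverage_le_of_singularValue_le {T W : H →L[ℂ] H} {c : ℝ}
    (h : ∀ n, singularValue W n ≤ c * singularValue T n) (k : ℕ) :
    logAverage W k ≤ c * logAverage T k := by
  rw [logAverage, logAverage, ← mul_div_assoc, Finset.mul_sum]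
  have : 0 < Real.log (1 + ((k + 1 : ℕ) : ℝ)) := Real.log_pos (by push_cast; linarith)
  gcongr with i
  exact h i

theorem bddAbove_logAverage_of_singularValue_le {T W : H →L[ℂ] H} (hT : T ∈ dixmierIdeal H)
    {c : ℝ} (hc : 0 ≤ c) (h : ∀ n, singularValue W n ≤ c * singularValue T n) :
    BddAbove (Set.range (logAverage W)) := by
  obtain ⟨B, hB⟩ := hT.2
  refine ⟨c * B, ?_⟩
  rintro _ ⟨k, rfl⟩
  exact (logAverage_le_of_singularValue_le h k).trans
    (mul_le_mul_of_nonneg_left (hB ⟨k, rfl⟩) hc)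

theorem mem_dixmierIdeal_of_norm_le {T W : H →L[ℂ] H} (hT : T ∈ dixmierIdeal H) {c : ℝ}
    (hc : 0 ≤ c) (h : ∀ y, ‖W y‖ ≤ c * ‖T y‖) : W ∈ dixmierIdeal H :=
  ⟨isCompactOperator_of_norm_le hT.1 h,
    bddAbove_logAverage_of_singularValue_le hT hc (singularValue_le_of_norm_le hT.1 hc h)⟩

theorem dixmierNorm_le_of_norm_le {T W : H →L[ℂ] H} (hT : T ∈ dixmierIdeal H) {c : ℝ}
    (hc : 0 ≤ c) (h : ∀ y, ‖W y‖ ≤ c * ‖T y‖) : dixmierNorm W ≤ c * dixmierNorm T :=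
  ciSup_le fun k => (logAverage_le_of_singularValue_le (singularValue_le_of_norm_le hT.1 hc h)
    k).trans (mul_le_mul_of_nonneg_left (le_ciSup hT.2 k) hc)

theorem dixmierNorm_nonneg (T : H →L[ℂ] H) : 0 ≤ dixmierNorm T := by
  refine Real.iSup_nonneg fun k => div_nonneg (Finset.sum_nonneg fun i _ =>
    singularValue_nonneg T i) (Real.log_nonneg (by push_cast; linarith))

theorem mul_mem_dixmierIdeal {T : H →L[ℂ] H} (hT : T ∈ dixmierIdeal H) (a : H →L[ℂ] H) :
    a * T ∈ dixmierIdeal H :=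
  mem_dixmierIdeal_of_norm_le hT (norm_nonneg a) (norm_mul_apply_le a T)

theorem mem_dixmierIdeal_mul {T : H →L[ℂ] H} (hT : T ∈ dixmierIdeal H) (a : H →L[ℂ] H) :
    T * a ∈ dixmierIdeal H :=
  ⟨hT.1.comp_clm a, bddAbove_logAverage_of_singularValue_le hT (norm_nonneg a)
    (singularValue_mul_right_le hT.1 a)⟩

end NCG

namespace NCG

/-! ### Positive functionals and the functional `X ↦ ρ (X E)` -/

/-- A positive functional on a unital C⋆-algebra attains its norm at the unit. -/
theorem _root_.PositiveLinearMap.norm_apply_le_norm_mul_norm_apply_one {A : Type*} [CStarAlgebra A]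
    [PartialOrder A] [StarOrderedRing A] (f : A →ₚ[ℂ] ℂ) (x : A) : ‖f x‖ ≤ ‖x‖ * ‖f 1‖ := by
  -- `u` is the phase that makes `f (u x)` real and nonnegative
  obtain ⟨u, hu, hux⟩ : ∃ u : ℂ, ‖u‖ = 1 ∧ u * f x = (‖f x‖ : ℂ) := by
    by_cases h0 : f x = 0
    · exact ⟨1, by simp, by simp [h0]⟩
    · refine ⟨(‖f x‖ : ℂ) / f x, ?_, div_mul_cancel₀ _ h0⟩
      rw [norm_div, Complex.norm_real, norm_norm, div_self (norm_ne_zero_iff.mpr h0)]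
  set S : A := (realPart (u • x) : A) with hS
  have hSsa : IsSelfAdjoint S := (realPart (u • x)).2
  have hSn : ‖realPart (u • x)‖ ≤ ‖x‖ := by
    have h1 : ‖realPart (u • x)‖ ≤ ‖u • x‖ := realPart.norm_le _
    rwa [norm_smul, hu, one_mul] at h1
  have hfS : f S = (‖f x‖ : ℂ) := by
    have h1 : f (u • x) = (‖f x‖ : ℂ) := by rw [map_smul, smul_eq_mul, hux]
    rw [hS, realPart_apply_coe, ← Complex.coe_smul, map_smul, map_add, map_star, h1]
    simp only [smul_eq_mul, Complex.star_def, Complex.conj_ofReal]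
    push_cast
    ring
  have h1 := f.apply_le_of_isSelfAdjoint S hSsa
  rw [hfS, Algebra.algebraMap_eq_smul_one, ← Complex.coe_smul, map_smul] at h1
  have hpos : 0 ≤ f 1 := f.map_nonneg zero_le_one
  calc ‖f x‖ = ‖((‖f x‖ : ℝ) : ℂ)‖ := by simp
    _ ≤ ‖((‖S‖ : ℝ) : ℂ) • f 1‖ := CStarAlgebra.norm_le_norm_of_nonneg_of_le (by simp) h1
    _ = ‖S‖ * ‖f 1‖ := by rw [norm_smul]; simp
    _ ≤ ‖x‖ * ‖f 1‖ := mul_le_mul_of_nonneg_right hSn (norm_nonneg _)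

variable {H : Type*} [NormedAddCommGroup H] [InnerProductSpace ℂ H] [CompleteSpace H]
  {ρ : (H →L[ℂ] H) → ℂ}

namespace IsPositiveSingularTrace

theorem apply_mul_comm (hρ : IsPositiveSingularTrace ρ) (a : H →L[ℂ] H) {T : H →L[ℂ] H}
    (hT : T ∈ dixmierIdeal H) : ρ (a * T) = ρ (T * a) := by
  have h := hρ.map_commutator a T hT
  have h1 := mem_dixmierIdeal_mul hT a
  have h2 : (-1 : ℂ) • (T * a) ∈ dixmierIdeal H := by
    have := mul_mem_dixmierIdeal h1 ((-1 : ℂ) • 1)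
    rwa [smul_mul_assoc, one_mul] at this
  have h3 : a * T - T * a = a * T + (-1 : ℂ) • (T * a) := by simp [sub_eq_add_neg]
  rw [h3, hρ.map_add _ (mul_mem_dixmierIdeal hT a) _ h2, hρ.map_smul _ _ h1] at h
  linear_combination h

/-- Continuity of `ρ`, expressed by vectorwise domination by a fixed element of the ideal. -/
theorem exists_norm_le (hρ : IsPositiveSingularTrace ρ) {E : H →L[ℂ] H}
    (hE : E ∈ dixmierIdeal H) : ∃ C : ℝ, 0 ≤ C ∧ ∀ (W : H →L[ℂ] H) (c : ℝ), 0 ≤ c →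
      (∀ y, ‖W y‖ ≤ c * ‖E y‖) → ‖ρ W‖ ≤ C * c := by
  obtain ⟨C, hC⟩ := hρ.continuous
  refine ⟨|C| * dixmierNorm E, mul_nonneg (abs_nonneg C) (dixmierNorm_nonneg E), ?_⟩
  intro W c hc h
  calc ‖ρ W‖ ≤ C * dixmierNorm W := hC W (mem_dixmierIdeal_of_norm_le hE hc h)
    _ ≤ |C| * (c * dixmierNorm E) :=
      mul_le_mul (le_abs_self C) (dixmierNorm_le_of_norm_le hE hc h) (dixmierNorm_nonneg W)
        (abs_nonneg C)
    _ = |C| * dixmierNorm E * c := by ring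

/-- `X ↦ ρ (X E)` is a bounded linear functional on the algebra of all bounded operators. -/
theorem exists_functional (hρ : IsPositiveSingularTrace ρ) {E : H →L[ℂ] H}
    (hE : E ∈ dixmierIdeal H) : ∃ φ : (H →L[ℂ] H) →L[ℂ] ℂ, ∀ X, φ X = ρ (X * E) := by
  obtain ⟨C, -, hC⟩ := hρ.exists_norm_le hE
  let f : (H →L[ℂ] H) →ₗ[ℂ] ℂ :=
    { toFun := fun X => ρ (X * E)
      map_add' := fun X Y => by
        rw [add_mul]
        exact hρ.map_add _ (mul_mem_dixmierIdeal hE X) _ (mul_mem_dixmierIdeal hE Y)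
      map_smul' := fun c X => by
        rw [smul_mul_assoc]
        exact hρ.map_smul c _ (mul_mem_dixmierIdeal hE X) }
  exact ⟨f.mkContinuous C fun X => hC _ _ (norm_nonneg X) (norm_mul_apply_le X E), fun X => rfl⟩

/-- Positivity of `X ↦ ρ (X E)`: cyclicity gives `ρ (X E) = ρ (√X E √X)`, and `√X E √X` is
positive. -/
theorem apply_mul_nonneg (hρ : IsPositiveSingularTrace ρ) {E : H →L[ℂ] H}
    (hE : E ∈ dixmierIdeal H) (hE0 : 0 ≤ E) {X : H →L[ℂ] H} (hX : 0 ≤ X) : 0 ≤ ρ (X * E) := by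
  have hc : IsSelfAdjoint (CFC.sqrt X) := .of_nonneg (CFC.sqrt_nonneg X)
  have hcE := mul_mem_dixmierIdeal hE (CFC.sqrt X)
  rw [← CFC.sqrt_mul_sqrt_self X hX, mul_assoc, hρ.apply_mul_comm _ hcE]
  refine hρ.nonneg _ (mem_dixmierIdeal_mul hcE _) ?_
  have := star_right_conjugate_nonneg hE0 (CFC.sqrt X)
  rwa [hc.star_eq] at this

theorem norm_apply_mul_le (hρ : IsPositiveSingularTrace ρ) {E : H →L[ℂ] H}
    (hE : E ∈ dixmierIdeal H) (hE0 : 0 ≤ E) (X : H →L[ℂ] H) : ‖ρ (X * E)‖ ≤ ‖X‖ * ‖ρ E‖ := by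
  obtain ⟨φ, hφ⟩ := hρ.exists_functional hE
  have h := (PositiveLinearMap.mk₀ (φ : (H →L[ℂ] H) →ₗ[ℂ] ℂ) fun X hX => by
    simpa [hφ] using hρ.apply_mul_nonneg hE hE0 hX).norm_apply_le_norm_mul_norm_apply_one X
  change ‖φ X‖ ≤ ‖X‖ * ‖φ 1‖ at h
  rwa [hφ, hφ, one_mul] at h

theorem apply_mul_eq_zero_of_finiteRank (hρ : IsPositiveSingularTrace ρ) (E : H →L[ℂ] H)
    {F : H →L[ℂ] H} (hF : FiniteDimensional ℂ (LinearMap.range (F : H →ₗ[ℂ] H))) :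
    ρ (F * E) = 0 := by
  refine hρ.map_finiteRank _ ?_
  refine Submodule.finiteDimensional_of_le (S₂ := LinearMap.range (F : H →ₗ[ℂ] H)) ?_
  rintro _ ⟨x, rfl⟩
  exact ⟨E x, rfl⟩

end IsPositiveSingularTrace

end NCG

namespace NCG

variable {H : Type*} [NormedAddCommGroup H] [InnerProductSpace ℂ H]

/-! ### The commutator condition in bounded form -/

/-- A bound on the sesquilinear form of `[b, G²]` that expresses, for `G = (1 + D²)^(-1/2)` and
without mentioning the unbounded operator `D`, that `[D, b]` is bounded. -/
def CommutatorBound (G b : H →L[ℂ] H) (M : ℝ) : Prop :=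
  ∀ x y, ‖inner ℂ y (b (G (G x))) - inner ℂ (G (G y)) (b x)‖ ≤
    M * (‖G y‖ * ‖G (G x)‖ + ‖G (G y)‖ * ‖G x‖)

variable [CompleteSpace H]

theorem CommutatorBound.adjoint {G b : H →L[ℂ] H} {M : ℝ} (h : CommutatorBound G b M) :
    CommutatorBound G (ContinuousLinearMap.adjoint b) M := by
  intro x y
  have h1 := h y x
  rw [ContinuousLinearMap.adjoint_inner_right, ContinuousLinearMap.adjoint_inner_right,
    ← norm_neg, neg_sub, ← Complex.norm_conj, map_sub, inner_conj_symm, inner_conj_symm]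
  refine h1.trans (le_of_eq ?_)
  ring

theorem angleInv_nonneg (D : H →ₗ.[ℂ] H) (hD : IsSelfAdjoint D) : 0 ≤ angleInv D hD :=
  CFC.sqrt_nonneg _

theorem angleInv_angleInv (D : H →ₗ.[ℂ] H) (hD : IsSelfAdjoint D) (x : H) :
    angleInv D hD (angleInv D hD x) = oneAddSqInv D hD x := by
  rw [← mul_apply_eq_comp, angleInv, CFC.sqrt_mul_sqrt_self _ (oneAddSqInv_nonneg D hD)]

theorem norm_angleInv_sq (D : H →ₗ.[ℂ] H) (hD : IsSelfAdjoint D) (x : H)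
    (h : oneAddSqInv D hD x ∈ D.domain) :
    ‖angleInv D hD x‖ ^ 2 = ‖oneAddSqInv D hD x‖ ^ 2 + ‖D ⟨oneAddSqInv D hD x, h⟩‖ ^ 2 := by
  obtain ⟨_, h', hx⟩ := oneAddSqInv_spec D hD x
  have h1 := inner_symm_of_isSelfAdjoint hD ⟨oneAddSqInv D hD x, h⟩
    ⟨D ⟨oneAddSqInv D hD x, h⟩, h'⟩
  have h2 : inner ℂ (oneAddSqInv D hD x) x = inner ℂ (oneAddSqInv D hD x)
      (oneAddSqInv D hD x + D ⟨D ⟨oneAddSqInv D hD x, h⟩, h'⟩) := by rw [hx]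
  have h3 : inner ℂ (oneAddSqInv D hD x) x = inner ℂ (angleInv D hD x) (angleInv D hD x) := by
    rw [← angleInv_angleInv]
    exact isSymmetric_of_nonneg (angleInv_nonneg D hD) (angleInv D hD x) x
  rw [inner_add_right, ← h1, h3, inner_self_eq_norm_sq_to_K, inner_self_eq_norm_sq_to_K,
    inner_self_eq_norm_sq_to_K] at h2
  exact_mod_cast h2

theorem norm_angleInv_le (D : H →ₗ.[ℂ] H) (hD : IsSelfAdjoint D) (x : H) :
    ‖angleInv D hD x‖ ≤ ‖x‖ := by
  obtain ⟨h, -, -⟩ := oneAddSqInv_spec D hD x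
  have h1 := norm_angleInv_sq D hD x h
  have h2 := isSymmetric_of_nonneg (angleInv_nonneg D hD) (angleInv D hD x) x
  simp only [ContinuousLinearMap.coe_coe] at h2
  rw [angleInv_angleInv, inner_self_eq_norm_sq_to_K] at h2
  have h3 := norm_inner_le_norm (𝕜 := ℂ) (oneAddSqInv D hD x) x
  rw [h2] at h3
  simp only [norm_pow, RCLike.norm_ofReal, abs_norm] at h3
  have h4 : ‖oneAddSqInv D hD x‖ ≤ ‖angleInv D hD x‖ := by
    refine le_of_sq_le_sq ?_ (norm_nonneg _)
    have := sq_nonneg ‖D ⟨oneAddSqInv D hD x, h⟩‖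
    linarith
  by_contra! hlt
  have h5 : 0 < ‖angleInv D hD x‖ := (norm_nonneg x).trans_lt hlt
  have h6 : ‖oneAddSqInv D hD x‖ * ‖x‖ ≤ ‖angleInv D hD x‖ * ‖x‖ := by gcongr
  have h7 : ‖angleInv D hD x‖ * ‖x‖ < ‖angleInv D hD x‖ * ‖angleInv D hD x‖ := by gcongr
  nlinarith

theorem eq_zero_of_angleInv_eq_zero (D : H →ₗ.[ℂ] H) (hD : IsSelfAdjoint D) {x : H}
    (hx : angleInv D hD x = 0) : x = 0 := by
  have hR : oneAddSqInv D hD x = 0 := by rw [← angleInv_angleInv, hx, map_zero]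
  obtain ⟨h, h', hxx⟩ := oneAddSqInv_spec D hD x
  have h1 : D ⟨oneAddSqInv D hD x, h⟩ = 0 := by
    rw [show (⟨oneAddSqInv D hD x, h⟩ : D.domain) = 0 from Subtype.ext hR, LinearPMap.map_zero]
  have h2 : D ⟨D ⟨oneAddSqInv D hD x, h⟩, h'⟩ = 0 := by
    rw [show (⟨D ⟨oneAddSqInv D hD x, h⟩, h'⟩ : D.domain) = 0 from Subtype.ext h1,
      LinearPMap.map_zero]
  rw [← hxx, h2, hR, add_zero]

/-- With `R = (1 + D²)⁻¹`, the identity `[b, R] = (D R)* [D, b] R + R [D, b] (D R)` holds in the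
sense of forms; it remains to use `‖D R x‖ ≤ ‖⟨D⟩⁻¹ x‖`. -/
theorem SpectralTriple.exists_commutatorBound (X : SpectralTriple H) {b : H →L[ℂ] H}
    (hb : b ∈ X.A) : ∃ M : ℝ, 0 ≤ M ∧ CommutatorBound (angleInv X.D X.isSelfAdjoint) b M := by
  obtain ⟨C, hC⟩ := X.commutator_bounded b hb
  refine ⟨|C|, abs_nonneg C, fun x y => ?_⟩
  have hD := X.isSelfAdjoint
  obtain ⟨hx, hx', hxx⟩ := oneAddSqInv_spec X.D hD x
  obtain ⟨hy, hy', hyy⟩ := oneAddSqInv_spec X.D hD y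
  simp only [angleInv_angleInv]
  have hnx := norm_angleInv_sq X.D hD x hx
  have hny := norm_angleInv_sq X.D hD y hy
  set u := oneAddSqInv X.D hD x
  set v := oneAddSqInv X.D hD y
  set u' := X.D ⟨u, hx⟩
  set v' := X.D ⟨v, hy⟩
  have hu' : ‖u'‖ ≤ ‖angleInv X.D hD x‖ :=
    le_of_sq_le_sq (by linarith [sq_nonneg ‖u‖]) (norm_nonneg _)
  have hv' : ‖v'‖ ≤ ‖angleInv X.D hD y‖ :=
    le_of_sq_le_sq (by linarith [sq_nonneg ‖v‖]) (norm_nonneg _)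
  have hbu := X.map_domain b hb u hx
  have hbu' := X.map_domain b hb u' hx'
  have c1 : ‖X.D ⟨b u, hbu⟩ - b u'‖ ≤ |C| * ‖u‖ :=
    (hC ⟨u, hx⟩).trans (by gcongr; exact le_abs_self C)
  have c2 : ‖X.D ⟨b u', hbu'⟩ - b (X.D ⟨u', hx'⟩)‖ ≤ |C| * ‖u'‖ :=
    (hC ⟨u', hx'⟩).trans (by gcongr; exact le_abs_self C)
  have e1 : inner ℂ y (b u) = inner ℂ v (b u) + inner ℂ v' (X.D ⟨b u, hbu⟩) := by
    have := inner_symm_of_isSelfAdjoint hD ⟨v', hy'⟩ ⟨b u, hbu⟩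
    simp only at this
    rw [← this, ← inner_add_left, hyy]
  have e2 : inner ℂ v (b x) = inner ℂ v (b u) + inner ℂ v (b (X.D ⟨u', hx'⟩)) := by
    rw [← inner_add_right, ← map_add, hxx]
  have e3 : inner ℂ v' (b u') = inner ℂ v (X.D ⟨b u', hbu'⟩) :=
    inner_symm_of_isSelfAdjoint hD ⟨v, hy⟩ ⟨b u', hbu'⟩
  have e4 : inner ℂ y (b u) - inner ℂ v (b x) = inner ℂ v' (X.D ⟨b u, hbu⟩ - b u') +
      inner ℂ v (X.D ⟨b u', hbu'⟩ - b (X.D ⟨u', hx'⟩)) := by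
    rw [e1, e2, inner_sub_right, inner_sub_right, e3]
    ring
  rw [e4]
  calc _ ≤ ‖v'‖ * ‖X.D ⟨b u, hbu⟩ - b u'‖ + ‖v‖ * ‖X.D ⟨b u', hbu'⟩ - b (X.D ⟨u', hx'⟩)‖ :=
        (norm_add_le _ _).trans (add_le_add (norm_inner_le_norm _ _) (norm_inner_le_norm _ _))
    _ ≤ ‖angleInv X.D hD y‖ * (|C| * ‖u‖) + ‖v‖ * (|C| * ‖angleInv X.D hD x‖) := by
        gcongr
        exact c2.trans (by gcongr)
    _ = _ := by ring

end NCG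

namespace NCG

variable {H : Type*} [NormedAddCommGroup H] [InnerProductSpace ℂ H]

/-! ### Band truncation along an increasing sequence of finite-dimensional subspaces -/

section Band

variable {S : ℕ → Submodule ℂ H} [∀ k, FiniteDimensional ℂ (S k)]

theorem starProjection_apply_of_le (hS : Monotone S) {k m : ℕ} (h : k ≤ m) {x : H} (hx : x ∈ S k) :
    (S m).starProjection x = x :=
  Submodule.starProjection_eq_self_iff.mpr (hS h hx)

theorem starProjection_apply_of_ge (hS : Monotone S) {k m : ℕ} (h : m ≤ k) {x : H}
    (hx : x ∈ (S k)ᗮ) : (S m).starProjection x = 0 :=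
  (Submodule.starProjection_apply_eq_zero_iff _).mpr (Submodule.orthogonal_le (hS h) hx)

theorem sub_starProjection_mem (hS : Monotone S) {k m : ℕ} (h : k ≤ m) (x : H) :
    (S m).starProjection x - (S k).starProjection x ∈ S m ∧
      (S m).starProjection x - (S k).starProjection x ∈ (S k)ᗮ := by
  refine ⟨Submodule.sub_mem _ (Submodule.starProjection_apply_mem _ _)
    (hS h (Submodule.starProjection_apply_mem _ _)), ?_⟩
  have h1 := Submodule.sub_starProjection_mem_orthogonal (K := S k) x
  have h2 := Submodule.orthogonal_le (hS h)
    (Submodule.sub_starProjection_mem_orthogonal (K := S m) x)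
  have := Submodule.sub_mem _ h1 h2
  rwa [show x - (S k).starProjection x - (x - (S m).starProjection x) =
    (S m).starProjection x - (S k).starProjection x by abel] at this

theorem norm_sub_starProjection_le (V : Submodule ℂ H) [V.HasOrthogonalProjection] (x : H) :
    ‖x - V.starProjection x‖ ≤ ‖x‖ := by
  have h := (Vᗮ).norm_starProjection_apply_le x
  rwa [Submodule.starProjection_orthogonal_val] at h

theorem norm_starProjection_sub_le (hS : Monotone S) {k m : ℕ} (h : k ≤ m) (x : H) :
    ‖(S m).starProjection x - (S k).starProjection x‖ ≤ ‖x‖ := by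
  have h1 : (S m).starProjection x - (S k).starProjection x =
      (S m).starProjection (x - (S k).starProjection x) := by
    rw [map_sub, starProjection_apply_of_le hS h (Submodule.starProjection_apply_mem _ _)]
  rw [h1]
  exact ((S m).norm_starProjection_apply_le _).trans (norm_sub_starProjection_le _ x)

/-- If the entries of `b` away from the three central block diagonals are summable, then `b` differs
from a block tridiagonal operator by a norm convergent series of finite rank operators. -/
theorem exists_band_truncation [CompleteSpace H] (hS : Monotone S) (hS0 : S 0 = ⊥)
    {b : H →L[ℂ] H} {β : ℕ → ℝ} (hβ : Summable β)
    (hup : ∀ k, ‖(S k).starProjection * b * (1 - (S (k + 1)).starProjection)‖ ≤ β k)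
    (hlow : ∀ k, ‖(1 - (S (k + 1)).starProjection) * b * (S k).starProjection‖ ≤ β k) :
    ∃ T : ℕ → H →L[ℂ] H, Summable T ∧
      (∀ k, FiniteDimensional ℂ (LinearMap.range (T k : H →ₗ[ℂ] H))) ∧
      ∀ k, ∀ x ∈ S (k + 1), x ∈ (S k)ᗮ → (b - ∑' j, T j) x =
        (S (k + 2)).starProjection (b x) - (S (k - 1)).starProjection (b x) := by
  set Q : ℕ → H →L[ℂ] H := fun k => (S k).starProjection with hQ
  have hQQ : ∀ {k m}, k ≤ m → Q m * Q k = Q k := fun {k m} h => by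
    ext x
    exact starProjection_apply_of_le hS h (Submodule.starProjection_apply_mem _ _)
  have hQQ' : ∀ {k m}, k ≤ m → Q k * Q m = Q k := fun {k m} h => by
    ext x
    have := starProjection_apply_of_ge hS h
      (Submodule.sub_starProjection_mem_orthogonal (K := S m) x)
    rw [map_sub, sub_eq_zero] at this
    exact this.symm
  have hQn : ∀ k, ‖1 - Q k‖ ≤ 1 := fun k =>
    ContinuousLinearMap.opNorm_le_bound _ zero_le_one fun x => by
      rw [one_mul]; exact norm_sub_starProjection_le (S k) x
  let U : ℕ → H →L[ℂ] H := fun k => (Q (k + 1) - Q k) * b * (1 - Q (k + 2))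
  let L : ℕ → H →L[ℂ] H := fun k => (1 - Q (k + 2)) * b * (Q (k + 1) - Q k)
  have hU : ∀ k, ‖U k‖ ≤ β (k + 1) := fun k => by
    have h1 : U k = (1 - Q k) * (Q (k + 1) * b * (1 - Q (k + 1 + 1))) := by
      have : Q (k + 1) - Q k = (1 - Q k) * Q (k + 1) := by
        rw [sub_mul, one_mul, hQQ' (Nat.le_succ k)]
      simp only [U, this, mul_assoc]
    rw [h1]
    calc _ ≤ ‖1 - Q k‖ * ‖Q (k + 1) * b * (1 - Q (k + 1 + 1))‖ := norm_mul_le _ _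
      _ ≤ 1 * β (k + 1) := mul_le_mul (hQn k) (hup (k + 1)) (norm_nonneg _) zero_le_one
      _ = _ := one_mul _
  have hL : ∀ k, ‖L k‖ ≤ β (k + 1) := fun k => by
    have h1 : L k = ((1 - Q (k + 1 + 1)) * b * Q (k + 1)) * (1 - Q k) := by
      have : Q (k + 1) - Q k = Q (k + 1) * (1 - Q k) := by
        rw [mul_sub, mul_one, hQQ (Nat.le_succ k)]
      simp only [L, this, mul_assoc]
    rw [h1]
    calc _ ≤ ‖(1 - Q (k + 1 + 1)) * b * Q (k + 1)‖ * ‖1 - Q k‖ := norm_mul_le _ _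
      _ ≤ β (k + 1) * 1 := mul_le_mul (hlow (k + 1)) (hQn k) (norm_nonneg _)
          ((norm_nonneg _).trans (hlow (k + 1)))
      _ = _ := mul_one _
  have hβ' : Summable fun k => β (k + 1) := (summable_nat_add_iff 1).mpr hβ
  have hT : Summable fun k => U k + L k := by
    exact (Summable.of_norm_bounded hβ' hU).add (Summable.of_norm_bounded hβ' hL)
  refine ⟨fun k => U k + L k, hT, fun k => ?_, fun k x hx hx' => ?_⟩
  · refine Submodule.finiteDimensional_of_le (S₂ := S (k + 1) ⊔ (S (k + 1)).map
      (((1 - Q (k + 2)) * b : H →L[ℂ] H) : H →ₗ[ℂ] H)) ?_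
    rintro _ ⟨x, rfl⟩
    refine Submodule.add_mem_sup ?_ ?_
    · exact (sub_starProjection_mem hS (Nat.le_succ k) _).1
    · exact ⟨_, (sub_starProjection_mem hS (Nat.le_succ k) x).1, rfl⟩
  · have hQx : ∀ m, Q m x = if k + 1 ≤ m then x else 0 := fun m => by
      split_ifs with h
      · exact starProjection_apply_of_le hS h hx
      · exact starProjection_apply_of_ge hS (by omega) hx'
    have hsum : HasSum (fun j => (U j + L j) x) ((∑' j, (U j + L j)) x) :=
      hT.hasSum.mapL (ContinuousLinearMap.apply ℂ H x)
    have hterm : ∀ j, (U j + L j) x = (if j < k - 1 then Q (j + 1) (b x) - Q j (b x) else 0) +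
        (if j = k then b x - Q (k + 2) (b x) else 0) := by
      intro j
      rw [add_apply]
      congr 1
      · simp only [U, mul_apply_eq_comp, sub_apply, one_apply_eq_self, hQx]
        rcases lt_or_ge j (k - 1) with h | h
        · rw [if_neg (by omega), if_pos h, sub_zero]
        · rw [if_pos (by omega), if_neg (by omega)]
          simp
      · simp only [L, mul_apply_eq_comp, sub_apply, one_apply_eq_self, hQx]
        rcases lt_trichotomy j k with h | h | h
        · rw [if_neg (by omega), if_neg (by omega), if_neg (by omega)]
          simp
        · subst h
          rw [if_pos le_rfl, if_neg (by omega), if_pos rfl]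
          simp
        · rw [if_pos (by omega), if_pos (by omega), if_neg (by omega)]
          simp
    have hval : HasSum (fun j => (U j + L j) x)
        (Q (k - 1) (b x) + (b x - Q (k + 2) (b x))) := by
      simp only [hterm]
      refine HasSum.add ?_ (hasSum_ite_eq k _)
      have h1 : ∑ j ∈ Finset.range (k - 1),
          (if j < k - 1 then Q (j + 1) (b x) - Q j (b x) else 0) = Q (k - 1) (b x) := by
        rw [Finset.sum_congr rfl fun j hj => if_pos (Finset.mem_range.mp hj),
          Finset.sum_range_sub (fun j => Q j (b x))]
        have : Q 0 (b x) = 0 := by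
          exact (Submodule.mem_bot ℂ).mp (hS0.le (Submodule.starProjection_apply_mem (S 0) (b x)))
        rw [this, sub_zero]
      rw [← h1]
      refine hasSum_sum_of_ne_finset_zero fun j hj => if_neg ?_
      rwa [Finset.mem_range] at hj
    rw [sub_apply, hsum.unique hval]
    abel

/-- An operator `E` that is close to a scalar `e k` on the blocks `k - 1`, `k`, `k + 1`, relative to
the size of that scalar, almost commutes with block tridiagonal operators, relative to `E`. -/
theorem norm_commutator_le_of_band (hS : Monotone S) (hS0 : S 0 = ⊥)
    (hdense : (⨆ k, S k).topologicalClosure = ⊤) {b b₁ E : H →L[ℂ] H}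
    (hb₁ : ∀ k, ∀ x ∈ S (k + 1), x ∈ (S k)ᗮ → b₁ x =
        (S (k + 2)).starProjection (b x) - (S (k - 1)).starProjection (b x))
    (hES : ∀ k, ∀ x ∈ S k, E x ∈ S k) (hES' : ∀ k, ∀ x ∈ (S k)ᗮ, E x ∈ (S k)ᗮ)
    {e : ℕ → ℝ} (he : ∀ k, 0 ≤ e k) {δ : ℝ} (hδ : 0 ≤ δ) (hδ' : δ ≤ 1 / 2)
    (hE : ∀ k, ∀ z ∈ S (k + 2), z ∈ (S (k - 1))ᗮ → ‖E z - (e k : ℂ) • z‖ ≤ δ * e k * ‖z‖) (y : H) :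
    ‖(b₁ * E - E * b₁) y‖ ≤ 12 * δ * ‖b‖ * ‖E y‖ := by
  set W := b₁ * E - E * b₁ with hW
  have hWx : ∀ x, W x = b₁ (E x) - E (b₁ x) := fun x => rfl
  have hb₁n : ∀ k, ∀ x ∈ S (k + 1), x ∈ (S k)ᗮ → ‖b₁ x‖ ≤ ‖b‖ * ‖x‖ := fun k x hx hx' => by
    rw [hb₁ k x hx hx']
    exact (norm_starProjection_sub_le hS (by omega) _).trans (b.le_opNorm x)
  have hb₁m : ∀ k, ∀ x ∈ S (k + 1), x ∈ (S k)ᗮ → b₁ x ∈ S (k + 2) ∧ b₁ x ∈ (S (k - 1))ᗮ :=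
    fun k x hx hx' => by
      rw [hb₁ k x hx hx']
      exact sub_starProjection_mem hS (by omega) _
  have hEx : ∀ k, ∀ x ∈ S (k + 1), x ∈ (S k)ᗮ → ‖E x - (e k : ℂ) • x‖ ≤ δ * e k * ‖x‖ :=
    fun k x hx hx' => hE k x (hS (by omega) hx) (Submodule.orthogonal_le (hS (by omega)) hx')
  -- on a single block
  have hblock : ∀ k, ∀ x ∈ S (k + 1), x ∈ (S k)ᗮ → ‖W x‖ ≤ 4 * δ * ‖b‖ * ‖E x‖ := by
    intro k x hx hx'
    have h1 := hEx k x hx hx'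
    have hmem : E x - (e k : ℂ) • x ∈ S (k + 1) :=
      Submodule.sub_mem _ (hES _ x hx) (Submodule.smul_mem _ _ hx)
    have hmem' : E x - (e k : ℂ) • x ∈ (S k)ᗮ :=
      Submodule.sub_mem _ (hES' _ x hx') (Submodule.smul_mem _ _ hx')
    have h2 := hb₁n k _ hmem hmem'
    have h3 := hE k _ (hb₁m k x hx hx').1 (hb₁m k x hx hx').2
    have h4 := hb₁n k x hx hx'
    have h5 : W x = b₁ (E x - (e k : ℂ) • x) - (E (b₁ x) - (e k : ℂ) • b₁ x) := by
      rw [hWx, map_sub, map_smul]; abel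
    have hek := he k
    have h6 : e k * ‖x‖ ≤ 2 * ‖E x‖ := by
      have h7 : ‖(e k : ℂ) • x‖ ≤ ‖E x‖ + ‖E x - (e k : ℂ) • x‖ := by
        have := norm_sub_norm_le ((e k : ℂ) • x) (E x)
        rw [norm_sub_rev] at this
        linarith
      rw [norm_smul, Complex.norm_real, Real.norm_eq_abs, abs_of_nonneg hek] at h7
      have h8 : δ * e k * ‖x‖ ≤ 1 / 2 * (e k * ‖x‖) := by
        rw [mul_assoc]
        gcongr
      linarith
    calc ‖W x‖ ≤ ‖b₁ (E x - (e k : ℂ) • x)‖ + ‖E (b₁ x) - (e k : ℂ) • b₁ x‖ := by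
          rw [h5]; exact norm_sub_le _ _
      _ ≤ ‖b‖ * (δ * e k * ‖x‖) + δ * e k * (‖b‖ * ‖x‖) := by
          refine add_le_add (h2.trans ?_) (h3.trans ?_) <;> gcongr
      _ = 2 * δ * ‖b‖ * (e k * ‖x‖) := by ring
      _ ≤ 2 * δ * ‖b‖ * (2 * ‖E x‖) := by gcongr
      _ = 4 * δ * ‖b‖ * ‖E x‖ := by ring
  have hWm : ∀ k, ∀ x ∈ S (k + 1), x ∈ (S k)ᗮ → W x ∈ S (k + 2) ∧ W x ∈ (S (k - 1))ᗮ := by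
    intro k x hx hx'
    have h1 := hb₁m k x hx hx'
    have h2 := hb₁m k _ (hES _ x hx) (hES' _ x hx')
    exact ⟨Submodule.sub_mem _ h2.1 (hES _ _ h1.1), Submodule.sub_mem _ h2.2 (hES' _ _ h1.2)⟩
  -- on a vector with finitely many block components
  have hfin : ∀ y ∈ (⨆ k, S k), ‖W y‖ ≤ (12 * δ * ‖b‖) * ‖E y‖ := by
    intro y hy
    obtain ⟨N, hN⟩ := (Submodule.mem_iSup_of_directed S hS.directed_le).mp hy
    set p : ℕ → H := fun k => (S (k + 1)).starProjection y - (S k).starProjection y with hp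
    have hpm : ∀ k, p k ∈ S (k + 1) ∧ p k ∈ (S k)ᗮ := fun k =>
      sub_starProjection_mem hS (Nat.le_succ k) y
    have hsum : ∑ k ∈ Finset.range N, p k = y := by
      rw [Finset.sum_range_sub (fun k => (S k).starProjection y),
        starProjection_apply_of_le hS le_rfl hN]
      have h0 : (S 0).starProjection y = 0 :=
        (Submodule.mem_bot ℂ).mp (hS0.le (Submodule.starProjection_apply_mem (S 0) y))
      rw [h0, sub_zero]
    have horth : ∀ {k j : ℕ} {u v : H}, j ≤ k → u ∈ S j → v ∈ (S k)ᗮ → inner ℂ u v = 0 :=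
      fun {k j u v} hjk hu hv => Submodule.inner_right_of_mem_orthogonal (hS hjk hu) hv
    have hEsq : ‖E y‖ ^ 2 = ∑ k ∈ Finset.range N, ‖E (p k)‖ ^ 2 := by
      rw [← norm_sum_sq_of_pairwise_inner_eq_zero, ← map_sum, hsum]
      intro i _ j _ hij
      rcases lt_or_gt_of_ne hij with h | h
      · exact horth h (hES _ _ (hpm i).1) (hES' _ _ (hpm j).2)
      · exact inner_eq_zero_symm.mp (horth h (hES _ _ (hpm j).1) (hES' _ _ (hpm i).2))
    -- the images of blocks whose indices differ by at least three are orthogonal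
    have hclass : ∀ r, ‖∑ k ∈ Finset.range N with k % 3 = r, W (p k)‖ ≤
        4 * δ * ‖b‖ * ‖E y‖ := by
      intro r
      refine le_of_sq_le_sq ?_ (by positivity)
      rw [norm_sum_sq_of_pairwise_inner_eq_zero, mul_pow, hEsq, Finset.mul_sum]
      · refine (Finset.sum_le_sum fun k _ => ?_).trans (Finset.sum_le_sum_of_subset_of_nonneg
          (Finset.filter_subset _ _) fun k _ _ => by positivity)
        rw [← mul_pow]
        exact pow_le_pow_left₀ (norm_nonneg _) (hblock k _ (hpm k).1 (hpm k).2) 2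
      · intro i hi j hj hij
        have hi' := (Finset.mem_filter.mp hi).2
        have hj' := (Finset.mem_filter.mp hj).2
        rcases lt_or_gt_of_ne hij with h | h
        · exact horth (by omega) (hWm i _ (hpm i).1 (hpm i).2).1 (hWm j _ (hpm j).1 (hpm j).2).2
        · exact inner_eq_zero_symm.mp
            (horth (by omega) (hWm j _ (hpm j).1 (hpm j).2).1 (hWm i _ (hpm i).1 (hpm i).2).2)
    have hsplit : W y = ∑ r ∈ Finset.range 3, ∑ k ∈ Finset.range N with k % 3 = r, W (p k) := by
      rw [Finset.sum_fiberwise_of_maps_to fun k _ => Finset.mem_range.mpr (Nat.mod_lt k three_pos),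
        ← map_sum, hsum]
    rw [hsplit]
    calc _ ≤ ∑ r ∈ Finset.range 3, 4 * δ * ‖b‖ * ‖E y‖ :=
          (norm_sum_le _ _).trans (Finset.sum_le_sum fun r _ => hclass r)
      _ = 12 * δ * ‖b‖ * ‖E y‖ := by rw [Finset.sum_const, Finset.card_range]; ring
  exact norm_apply_le_of_mem_topologicalClosure hfin (hdense ▸ Submodule.mem_top)

end Band

/-! ### Off-diagonal decay -/

theorem apply_mem_spectralSpan {G B : H →L[ℂ] H} {J : Set ℝ} {g : ℝ → ℂ}
    (hB : ∀ r ∈ J, ∀ x, G x = (r : ℂ) • x → B x = g r • x) {x : H} (hx : x ∈ spectralSpan G J) :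
    B x ∈ spectralSpan G J := by
  have : spectralSpan G J ≤ (spectralSpan G J).comap (B : H →ₗ[ℂ] H) := by
    refine spectralSpan_le fun r hr x hx => ?_
    change B x ∈ spectralSpan G J
    rw [hB r hr x hx]
    exact Submodule.smul_mem _ _ (mem_spectralSpan_of_apply_eq hr hx)
  exact this hx

theorem apply_mem_orthogonal {A : H →L[ℂ] H} (hA : (A : H →ₗ[ℂ] H).IsSymmetric)
    {V : Submodule ℂ H} (h : ∀ x ∈ V, A x ∈ V) {x : H} (hx : x ∈ Vᗮ) : A x ∈ Vᗮ := by
  intro v hv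
  have := hA v x
  simp only [ContinuousLinearMap.coe_coe] at this
  rw [← this]
  exact hx _ (h v hv)

/-- The sum of the eigenspaces of `G` for the eigenvalues above `q⁻ᵏ`. For `q > 1` these spaces
increase with `k`; the differences of consecutive ones are the blocks of the band truncation. -/
def geometricSpan (G : H →L[ℂ] H) (q : ℝ) (k : ℕ) : Submodule ℂ H :=
  spectralSpan G (Set.Ioi (q ^ k)⁻¹)

theorem geometricSpan_mono (G : H →L[ℂ] H) {q : ℝ} (hq : 1 < q) : Monotone (geometricSpan G q) :=
  fun _ _ h => spectralSpan_mono G (Set.Ioi_subset_Ioi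
    (inv_anti₀ (pow_pos (one_pos.trans hq) _) (pow_le_pow_right₀ hq.le h)))

theorem geometricSpan_zero {G : H →L[ℂ] H} (hG1 : ∀ x, ‖G x‖ ≤ ‖x‖) (q : ℝ) :
    geometricSpan G q 0 = ⊥ := by
  refine eq_bot_iff.mpr (spectralSpan_le fun r hr x hx => ?_)
  rw [pow_zero, inv_one, Set.mem_Ioi] at hr
  have h1 := hG1 x
  rw [hx, norm_smul, Complex.norm_real, Real.norm_eq_abs, abs_of_pos (by linarith)] at h1
  by_contra hx0
  have : 0 < ‖x‖ := norm_pos_iff.mpr hx0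
  nlinarith

theorem apply_mem_geometricSpan {G : H →L[ℂ] H} {q : ℝ} {k : ℕ} {x : H}
    (hx : x ∈ geometricSpan G q k) : G x ∈ geometricSpan G q k :=
  apply_mem_spectralSpan (g := fun r => (r : ℂ)) (fun _ _ _ hx => hx) hx

variable [CompleteSpace H]

theorem topologicalClosure_iSup_geometricSpan {G : H →L[ℂ] H} (hG : 0 ≤ G)
    (hc : IsCompactOperator G) (hinj : ∀ x, G x = 0 → x = 0) {q : ℝ} (hq : 1 < q) :
    (⨆ k, geometricSpan G q k).topologicalClosure = ⊤ := by
  rw [Submodule.topologicalClosure_eq_top_iff, eq_bot_iff,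
    ← orthogonal_spectralSpan_Ici_eq_bot hG hc]
  refine Submodule.orthogonal_le (spectralSpan_le fun r hr x hx => ?_)
  rcases eq_or_lt_of_le (Set.mem_Ici.mp hr) with h0 | h0
  · rw [← h0, Complex.ofReal_zero, zero_smul] at hx
    rw [hinj x hx]
    exact Submodule.zero_mem _
  · obtain ⟨k, hk⟩ := pow_unbounded_of_one_lt r⁻¹ hq
    exact Submodule.mem_iSup_of_mem k
      (mem_spectralSpan_of_apply_eq (inv_lt_of_inv_lt₀ h0 hk) hx)

theorem finiteDimensional_geometricSpan {G : H →L[ℂ] H} (hG : 0 ≤ G) (hc : IsCompactOperator G)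
    {q : ℝ} (hq : 0 < q) (k : ℕ) : FiniteDimensional ℂ (geometricSpan G q k) :=
  finiteDimensional_spectralSpan_Ioi hG hc (inv_pos.mpr (pow_pos hq k))

/-- The commutator bound makes the entries of `b` between well separated spectral subspaces of `G`
small: this is the Sylvester equation for `b` and `G²`. -/
theorem norm_offDiagonal_le {G b : H →L[ℂ] H} (hG : 0 ≤ G) (hc : IsCompactOperator G)
    {M : ℝ} (hM : 0 ≤ M) (hb : CommutatorBound G b M) {q : ℝ} (hq : 1 < q) (k : ℕ)
    [FiniteDimensional ℂ (geometricSpan G q k)]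
    [FiniteDimensional ℂ (geometricSpan G q (k + 1))] :
    ‖(geometricSpan G q k).starProjection * b *
      (1 - (geometricSpan G q (k + 1)).starProjection)‖ ≤
      2 * M / (1 - (q ^ 2)⁻¹) * q⁻¹ ^ k := by
  set V := geometricSpan G q k with hV
  set V' := geometricSpan G q (k + 1) with hV'
  set Z := V.starProjection * b * (1 - V'.starProjection) with hZ
  have hq0 : 0 < q := one_pos.trans hq
  have hqk : 0 < q ^ k := by positivity
  have hGV : ∀ y ∈ V, G y ∈ V := fun y hy => apply_mem_geometricSpan hy
  have hGV' : ∀ y ∈ V', G y ∈ V' := fun y hy => apply_mem_geometricSpan hy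
  have hlow : ∀ y ∈ V, ‖y‖ ≤ q ^ k * ‖G y‖ := fun y hy => by
    have := le_norm_apply_of_mem_spectralSpan_Ioi hG (inv_nonneg.mpr hqk.le) hy
    rwa [inv_mul_le_iff₀ hqk] at this
  -- `G` is invertible on the finite-dimensional space `V`
  have hsurj : ∀ y ∈ V, ∃ z ∈ V, G z = y := by
    let g : V →ₗ[ℂ] V := (G : H →ₗ[ℂ] H).restrict hGV
    have hinj : Function.Injective g := by
      rw [← LinearMap.ker_eq_bot, LinearMap.ker_eq_bot']
      intro z hz
      have h1 := hlow z z.2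
      have h2 : G z = 0 := congrArg Subtype.val hz
      rw [h2, norm_zero, mul_zero] at h1
      exact Subtype.ext (norm_le_zero_iff.mp h1)
    intro y hy
    obtain ⟨z, hz⟩ := LinearMap.injective_iff_surjective.mp hinj ⟨y, hy⟩
    exact ⟨z, z.2, congrArg Subtype.val hz⟩
  have hGsym := isSymmetric_of_nonneg hG
  have hZin : ∀ y ∈ V, ∀ x ∈ V'ᗮ, inner ℂ y (b x) = inner ℂ y (Z x) := by
    intro y hy x hx
    have h1 : V'.starProjection x = 0 := (Submodule.starProjection_apply_eq_zero_iff _).mpr hx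
    have h2 : Z x = V.starProjection (b x) := by
      simp [hZ, h1]
    have h3 := V.starProjection_isSymmetric y (b x)
    simp only [ContinuousLinearMap.coe_coe] at h3
    rw [h2, ← h3, Submodule.starProjection_eq_self_iff.mpr hy]
  -- the form of `b` on `V × V'ᗮ` is bounded by a fraction of its own norm plus the commutator
  have hform : ∀ y ∈ V, ∀ x ∈ V'ᗮ,
      ‖inner ℂ y (b x)‖ ≤ (‖Z‖ * (q ^ 2)⁻¹ + 2 * M * q⁻¹ ^ k) * ‖y‖ * ‖x‖ := by
    intro y hy x hx
    obtain ⟨w, hw, hwy⟩ := hsurj y hy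
    obtain ⟨z, hz, hzw⟩ := hsurj w hw
    have hGx : G x ∈ V'ᗮ := apply_mem_orthogonal hGsym hGV' hx
    have hGGx : G (G x) ∈ V'ᗮ := apply_mem_orthogonal hGsym hGV' hGx
    have hs : (0 : ℝ) ≤ (q ^ (k + 1))⁻¹ := by positivity
    have n1 := norm_apply_le_of_mem_orthogonal_spectralSpan hG hc hs hx
    have n2 := norm_apply_le_of_mem_orthogonal_spectralSpan hG hc hs hGx
    have n3 := hlow w hw
    have n4 := hlow z hz
    rw [hwy] at n3
    rw [hzw] at n4
    have hcomm := hb x z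
    rw [hzw, hwy] at hcomm
    have n2' : ‖G (G x)‖ ≤ (q ^ (k + 1))⁻¹ * ((q ^ (k + 1))⁻¹ * ‖x‖) :=
      n2.trans (by gcongr)
    have n4' : ‖z‖ ≤ q ^ k * (q ^ k * ‖y‖) := n4.trans (by gcongr)
    have hfirst : ‖inner ℂ z (b (G (G x)))‖ ≤ ‖Z‖ * (q ^ 2)⁻¹ * ‖y‖ * ‖x‖ := by
      rw [hZin z hz _ hGGx]
      calc _ ≤ ‖z‖ * ‖Z (G (G x))‖ := norm_inner_le_norm _ _
        _ ≤ ‖z‖ * (‖Z‖ * ‖G (G x)‖) := by gcongr; exact Z.le_opNorm _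
        _ ≤ (q ^ k * (q ^ k * ‖y‖)) *
            (‖Z‖ * ((q ^ (k + 1))⁻¹ * ((q ^ (k + 1))⁻¹ * ‖x‖))) := by gcongr
        _ = ‖Z‖ * (q ^ 2)⁻¹ * ‖y‖ * ‖x‖ := by field_simp; ring
    have hq1 : (q ^ (k + 1))⁻¹ ≤ q⁻¹ ^ k := by
      rw [inv_pow]
      exact inv_anti₀ hqk (pow_le_pow_right₀ hq.le (Nat.le_succ k))
    have hqk1 : q ^ k * (q ^ (k + 1))⁻¹ ≤ 1 := by
      rw [pow_succ, mul_inv, ← mul_assoc, mul_inv_cancel₀ hqk.ne', one_mul]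
      exact inv_le_one_of_one_le₀ hq.le
    have hsecond : M * (‖w‖ * ‖G (G x)‖ + ‖y‖ * ‖G x‖) ≤ 2 * M * q⁻¹ ^ k * ‖y‖ * ‖x‖ := by
      have e1 : ‖w‖ * ‖G (G x)‖ ≤ q⁻¹ ^ k * ‖y‖ * ‖x‖ :=
        calc _ ≤ (q ^ k * ‖y‖) * ((q ^ (k + 1))⁻¹ * ((q ^ (k + 1))⁻¹ * ‖x‖)) := by gcongr
          _ = (q ^ k * (q ^ (k + 1))⁻¹) * ((q ^ (k + 1))⁻¹ * ‖y‖ * ‖x‖) := by ring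
          _ ≤ 1 * (q⁻¹ ^ k * ‖y‖ * ‖x‖) := by gcongr
          _ = _ := one_mul _
      have e2 : ‖y‖ * ‖G x‖ ≤ q⁻¹ ^ k * ‖y‖ * ‖x‖ :=
        calc _ ≤ ‖y‖ * (q⁻¹ ^ k * ‖x‖) := by
              gcongr; exact n1.trans (by gcongr)
          _ = _ := by ring
      calc _ ≤ M * (q⁻¹ ^ k * ‖y‖ * ‖x‖ + q⁻¹ ^ k * ‖y‖ * ‖x‖) := by gcongr
        _ = _ := by ring
    have htri : ‖inner ℂ y (b x)‖ ≤ ‖inner ℂ z (b (G (G x)))‖ +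
        ‖inner ℂ z (b (G (G x))) - inner ℂ y (b x)‖ := by
      have := norm_sub_norm_le (inner ℂ y (b x)) (inner ℂ z (b (G (G x))))
      rw [norm_sub_rev] at this
      linarith
    calc _ ≤ ‖Z‖ * (q ^ 2)⁻¹ * ‖y‖ * ‖x‖ + 2 * M * q⁻¹ ^ k * ‖y‖ * ‖x‖ :=
          htri.trans (add_le_add hfirst (hcomm.trans hsecond))
      _ = _ := by ring
  have hc0 : 0 ≤ ‖Z‖ * (q ^ 2)⁻¹ + 2 * M * q⁻¹ ^ k := by positivity
  have hZle : ‖Z‖ ≤ ‖Z‖ * (q ^ 2)⁻¹ + 2 * M * q⁻¹ ^ k := by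
    refine Z.opNorm_le_bound hc0 fun v => ?_
    by_cases h0 : Z v = 0
    · rw [h0, norm_zero]; positivity
    set x := v - V'.starProjection v with hx
    have hxm : x ∈ V'ᗮ := Submodule.sub_starProjection_mem_orthogonal v
    have hZv : Z v = V.starProjection (b x) := by simp [hZ, hx]
    have hZx : Z x = Z v := by
      have h1 : V'.starProjection x = 0 := (Submodule.starProjection_apply_eq_zero_iff _).mpr hxm
      rw [hZv]
      simp [hZ, h1]
    have hZm : Z v ∈ V := by rw [hZv]; exact Submodule.starProjection_apply_mem _ _
    have h1 := hform (Z v) hZm x hxm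
    rw [hZin _ hZm _ hxm, hZx, inner_self_eq_norm_sq_to_K] at h1
    simp only [norm_pow, RCLike.norm_ofReal, abs_norm] at h1
    have h2 : 0 < ‖Z v‖ := norm_pos_iff.mpr h0
    have h3 : ‖x‖ ≤ ‖v‖ := norm_sub_starProjection_le V' v
    have h4 : ‖Z v‖ * ‖Z v‖ ≤
        ‖Z v‖ * ((‖Z‖ * (q ^ 2)⁻¹ + 2 * M * q⁻¹ ^ k) * ‖x‖) := by
      calc _ = ‖Z v‖ ^ 2 := by ring
        _ ≤ _ := h1
        _ = _ := by ring
    exact (le_of_mul_le_mul_left h4 h2).trans (by gcongr)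
  have hq2 : (q ^ 2)⁻¹ < 1 := inv_lt_one_of_one_lt₀ (one_lt_pow₀ hq two_ne_zero)
  rw [div_mul_eq_mul_div, le_div_iff₀ (by linarith)]
  linarith

/-- On the eigenvectors whose eigenvalue is within a factor `p` of `t`, the power `G ^ n` is
close to the scalar `t ^ n`. -/
theorem norm_rpow_apply_sub_le {G : H →L[ℂ] H} (hG : 0 ≤ G) {n : ℝ} (hn : 0 < n) {p δ : ℝ}
    (hp : 0 < p) (hδ : 0 ≤ δ) (hpn : p ^ n = 1 + δ) {t : ℝ} (ht : 0 < t) {z : H}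
    (hz : z ∈ spectralSpan G {r | t ≤ p * r ∧ r ≤ p * t}) :
    ‖(G ^ n) z - ((t ^ n : ℝ) : ℂ) • z‖ ≤ δ * t ^ n * ‖z‖ := by
  have hpos : ∀ r, t ≤ p * r → 0 < r := fun r h => pos_of_mul_pos_right (ht.trans_le h) hp.le
  refine norm_apply_le_of_mem_spectralSpan (B := G ^ n - ((t ^ n : ℝ) : ℂ) • (1 : H →L[ℂ] H))
    (isSymmetric_of_nonneg hG) (g := fun r => ((r ^ n : ℝ) : ℂ) - ((t ^ n : ℝ) : ℂ)) ?_
    (by positivity) ?_ hz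
  · intro r hr x hx
    rw [sub_apply, rpow_apply_of_apply_eq hG hn (hpos r hr.1).le hx, smul_apply,
      one_apply_eq_self, sub_smul]
  · intro r hr
    have hr0 := hpos r hr.1
    have htn : 0 < t ^ n := by positivity
    have hupper : r ^ n ≤ (1 + δ) * t ^ n := by
      rw [← hpn, ← Real.mul_rpow hp.le ht.le]
      exact Real.rpow_le_rpow hr0.le hr.2 hn.le
    have hlower : t ^ n ≤ (1 + δ) * r ^ n := by
      rw [← hpn, ← Real.mul_rpow hp.le hr0.le]
      exact Real.rpow_le_rpow ht.le hr.1 hn.le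
    rw [← Complex.ofReal_sub, Complex.norm_real, Real.norm_eq_abs, abs_le]
    constructor
    · nlinarith
    · linarith

/-- The bound of `norm_offDiagonal_le` for the adjoint of `b`, read below the diagonal of `b`. -/
theorem norm_offDiagonal_adjoint_le {G b : H →L[ℂ] H} (hG : 0 ≤ G) (hc : IsCompactOperator G)
    {M : ℝ} (hM : 0 ≤ M) (hb : CommutatorBound G b M) {q : ℝ} (hq : 1 < q) (k : ℕ)
    [FiniteDimensional ℂ (geometricSpan G q k)]
    [FiniteDimensional ℂ (geometricSpan G q (k + 1))] :
    ‖(1 - (geometricSpan G q (k + 1)).starProjection) * b *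
      (geometricSpan G q k).starProjection‖ ≤ 2 * M / (1 - (q ^ 2)⁻¹) * q⁻¹ ^ k := by
  have h1 := norm_offDiagonal_le hG hc hM hb.adjoint hq k
  rw [← norm_star, star_mul, star_mul, star_sub, star_one, ContinuousLinearMap.star_eq_adjoint b,
    (isSelfAdjoint_starProjection (geometricSpan G q k)).star_eq,
    (isSelfAdjoint_starProjection (geometricSpan G q (k + 1))).star_eq, ← mul_assoc]
  exact h1

theorem rpow_apply_mem_geometricSpan {G : H →L[ℂ] H} (hG : 0 ≤ G) {n : ℝ} (hn : 0 < n) {q : ℝ}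
    (hq : 0 < q) {k : ℕ} {x : H} (hx : x ∈ geometricSpan G q k) :
    (G ^ n) x ∈ geometricSpan G q k :=
  apply_mem_spectralSpan (g := fun r => ((r ^ n : ℝ) : ℂ)) (fun _ hr _ hx =>
    rpow_apply_of_apply_eq hG hn ((inv_pos.mpr (pow_pos hq k)).trans hr).le hx) hx

theorem norm_rpow_apply_sub_le_of_block {G : H →L[ℂ] H} (hG : 0 ≤ G) {n : ℝ} (hn : 0 < n)
    {q δ : ℝ} (hq : 1 < q) (hδ : 0 ≤ δ) (hqn : (q ^ 2) ^ n = 1 + δ) (k : ℕ) {z : H}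
    (hz : z ∈ geometricSpan G q (k + 2)) (hz' : z ∈ (geometricSpan G q (k - 1))ᗮ) :
    ‖(G ^ n) z - (((q ^ k)⁻¹ ^ n : ℝ) : ℂ) • z‖ ≤ δ * (q ^ k)⁻¹ ^ n * ‖z‖ := by
  have hq0 : 0 < q := one_pos.trans hq
  refine norm_rpow_apply_sub_le hG hn (by positivity) hδ hqn (by positivity)
    (spectralSpan_mono G ?_ (mem_spectralSpan_Ioc hG (inv_anti₀ (by positivity)
      (pow_le_pow_right₀ hq.le (by omega))) hz hz'))
  intro r hr
  refine ⟨?_, hr.2.trans ?_⟩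
  · calc (q ^ k)⁻¹ = q ^ 2 * (q ^ (k + 2))⁻¹ := by rw [pow_add]; field_simp
      _ ≤ q ^ 2 * r := by gcongr; exact hr.1.le
  · rw [← div_eq_mul_inv, le_div_iff₀ (by positivity), inv_mul_le_iff₀ (by positivity), ← pow_add]
    exact pow_le_pow_right₀ hq.le (by omega)

/-- The commutator of `b` with a power of `G` is, up to a norm convergent series of finite rank
corrections of `b`, arbitrarily small relative to that power. -/
theorem exists_small_commutator {G b : H →L[ℂ] H} (hG : 0 ≤ G) (hc : IsCompactOperator G)
    (hinj : ∀ x, G x = 0 → x = 0) (hG1 : ∀ x, ‖G x‖ ≤ ‖x‖) {M : ℝ} (hM : 0 ≤ M)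
    (hb : CommutatorBound G b M) {n : ℝ} (hn : 0 < n) {ε : ℝ} (hε : 0 < ε) :
    ∃ T : ℕ → H →L[ℂ] H, Summable T ∧
      (∀ k, FiniteDimensional ℂ (LinearMap.range (T k : H →ₗ[ℂ] H))) ∧
      ∀ y, ‖((b - ∑' j, T j) * G ^ n - G ^ n * (b - ∑' j, T j)) y‖ ≤ ε * ‖(G ^ n) y‖ := by
  obtain ⟨δ, hδ0, hδ2, hδε⟩ : ∃ δ : ℝ, 0 < δ ∧ δ ≤ 1 / 2 ∧ 12 * δ * ‖b‖ ≤ ε := by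
    refine ⟨min (1 / 2) (ε / (12 * (‖b‖ + 1))), lt_min (by norm_num) (by positivity),
      min_le_left _ _, ?_⟩
    have h1 := min_le_right (1 / 2) (ε / (12 * (‖b‖ + 1)))
    have h2 : 0 ≤ min (1 / 2) (ε / (12 * (‖b‖ + 1))) := le_min (by norm_num) (by positivity)
    rw [le_div_iff₀ (by positivity)] at h1
    linarith
  -- the ratio of the geometric partition of the spectrum, close to `1`
  obtain ⟨q, hq, hqn⟩ : ∃ q : ℝ, 1 < q ∧ (q ^ 2) ^ n = 1 + δ := by
    have hq : 1 < (1 + δ) ^ (1 / (2 * n)) := Real.one_lt_rpow (by linarith) (by positivity)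
    refine ⟨_, hq, ?_⟩
    rw [← Real.rpow_natCast _ 2, ← Real.rpow_mul (one_pos.trans hq).le,
      ← Real.rpow_mul (by linarith), Nat.cast_ofNat, one_div_mul_cancel (by positivity),
      Real.rpow_one]
  have hq0 : 0 < q := one_pos.trans hq
  have hfd := finiteDimensional_geometricSpan hG hc hq0
  have hβ : Summable fun k => 2 * M / (1 - (q ^ 2)⁻¹) * q⁻¹ ^ k :=
    (summable_geometric_of_lt_one (inv_nonneg.mpr hq0.le) (inv_lt_one_of_one_lt₀ hq)).mul_left _
  obtain ⟨T, hT, hTf, hTb⟩ := exists_band_truncation (geometricSpan_mono G hq)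
    (geometricSpan_zero hG1 q) hβ (fun k => norm_offDiagonal_le hG hc hM hb hq k)
    (fun k => norm_offDiagonal_adjoint_le hG hc hM hb hq k)
  refine ⟨T, hT, hTf, fun y => ?_⟩
  have h := norm_commutator_le_of_band (geometricSpan_mono G hq) (geometricSpan_zero hG1 q)
    (topologicalClosure_iSup_geometricSpan hG hc hinj hq) (E := G ^ n) hTb
    (fun k x hx => rpow_apply_mem_geometricSpan hG hn hq0 hx)
    (fun k x hx => apply_mem_orthogonal (isSymmetric_of_nonneg CFC.rpow_nonneg)
      (fun x hx => rpow_apply_mem_geometricSpan hG hn hq0 hx) hx)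
    (e := fun k => (q ^ k)⁻¹ ^ n) (fun k => by positivity) hδ0.le hδ2
    (fun k z hz hz' => norm_rpow_apply_sub_le_of_block hG hn hq hδ0.le hqn k hz hz') y
  exact h.trans (by gcongr)

end NCG

namespace NCG
variable {H : Type*} [NormedAddCommGroup H] [InnerProductSpace ℂ H] [CompleteSpace H]

/-! ### The trace property -/

theorem SpectralTriple.anglePow_nonneg (X : SpectralTriple H) (n : ℝ) : 0 ≤ X.anglePow n :=
  CFC.rpow_nonneg

theorem SpectralTriple.apply_mul_comm_anglePow (X : SpectralTriple H) {n : ℝ} (hn : 0 < n)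
    (hX : X.anglePow n ∈ dixmierIdeal H) {ρ : (H →L[ℂ] H) → ℂ} (hρ : IsPositiveSingularTrace ρ)
    (a : H →L[ℂ] H) {b : H →L[ℂ] H} (hb : b ∈ X.A) :
    ρ (a * b * X.anglePow n) = ρ (b * a * X.anglePow n) := by
  set E := X.anglePow n with hE
  obtain ⟨φ, hφ⟩ := hρ.exists_functional hX
  obtain ⟨C, hC0, hC⟩ := hρ.exists_norm_le hX
  obtain ⟨M, hM, hbM⟩ := X.exists_commutatorBound hb
  suffices h : ∀ ε : ℝ, 0 < ε → ‖ρ (a * b * E) - ρ (b * a * E)‖ ≤ C * ‖a‖ * ε by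
    have h0 : ‖ρ (a * b * E) - ρ (b * a * E)‖ ≤ 0 := by
      refine le_of_forall_pos_le_add fun η hη => ?_
      refine (h (η / (C * ‖a‖ + 1)) (by positivity)).trans ?_
      rw [zero_add, mul_div_assoc', div_le_iff₀ (by positivity)]
      nlinarith
    exact sub_eq_zero.mp (norm_le_zero_iff.mp h0)
  intro ε hε
  obtain ⟨T, hT, hTfin, hsmall⟩ := exists_small_commutator (angleInv_nonneg X.D X.isSelfAdjoint)
    X.isCompactOperator_angleInv (fun x => eq_zero_of_angleInv_eq_zero X.D X.isSelfAdjoint)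
    (norm_angleInv_le X.D X.isSelfAdjoint) hM hbM hn hε
  set K := ∑' j, T j with hK
  change ∀ y, ‖((b - K) * E - E * (b - K)) y‖ ≤ ε * ‖E y‖ at hsmall
  -- `ρ` does not see the correction `K`, a limit of finite rank operators
  have hvanish : ∀ F : H →L[ℂ] H, FiniteDimensional ℂ (LinearMap.range (F : H →ₗ[ℂ] H)) →
      φ F = 0 := fun F hF => by rw [hφ]; exact hρ.apply_mul_eq_zero_of_finiteRank E hF
  have haK : φ (a * K) = 0 := by
    have h1 := (hT.hasSum.mul_left a).mapL φ
    refine h1.unique ?_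
    have h2 : ∀ j, φ (a * T j) = 0 := fun j => by
      refine hvanish _ ?_
      have := hTfin j
      rw [show ((a * T j : H →L[ℂ] H) : H →ₗ[ℂ] H) = (a : H →ₗ[ℂ] H) ∘ₗ (T j : H →ₗ[ℂ] H) from rfl,
        LinearMap.range_comp]
      infer_instance
    simp only [h2]
    exact hasSum_zero
  have hKa : φ (K * a) = 0 := by
    have h1 := (hT.hasSum.mul_right a).mapL φ
    refine h1.unique ?_
    have h2 : ∀ j, φ (T j * a) = 0 := fun j => by
      refine hvanish _ ?_
      have := hTfin j
      refine Submodule.finiteDimensional_of_le (S₂ := LinearMap.range (T j : H →ₗ[ℂ] H)) ?_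
      rintro _ ⟨x, rfl⟩
      exact ⟨a x, rfl⟩
    simp only [h2]
    exact hasSum_zero
  have haE := mul_mem_dixmierIdeal hX a
  have hmem : (b - K) * E - E * (b - K) ∈ dixmierIdeal H :=
    mem_dixmierIdeal_of_norm_le hX hε.le hsmall
  -- cyclicity turns `ρ (a b E) - ρ (b a E)` into the value of `ρ` on `a [b - K, E]`
  have h1 : ρ (a * (b - K) * E) = ρ (a * b * E) := by
    rw [← hφ, ← hφ, mul_sub, map_sub, haK, sub_zero]
  have h2 : ρ ((b - K) * a * E) = ρ (b * a * E) := by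
    rw [← hφ, ← hφ, sub_mul, map_sub, hKa, sub_zero]
  have h3 : ρ (a * (b - K) * E) = ρ (a * ((b - K) * E - E * (b - K))) + ρ ((b - K) * a * E) := by
    rw [mul_assoc (b - K) a E, hρ.apply_mul_comm (b - K) haE, mul_assoc a E,
      ← hρ.map_add _ (mul_mem_dixmierIdeal hmem a) _
        (by rw [← mul_assoc]; exact mem_dixmierIdeal_mul haE _), ← mul_add, sub_add_cancel,
      mul_assoc]
  rw [← h1, ← h2, h3, add_sub_cancel_right, mul_assoc C]
  refine hC _ _ (by positivity) fun y => ?_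
  calc ‖(a * ((b - K) * E - E * (b - K))) y‖ ≤ ‖a‖ * ‖((b - K) * E - E * (b - K)) y‖ :=
        norm_mul_apply_le _ _ _
    _ ≤ ‖a‖ * (ε * ‖E y‖) := by gcongr; exact hsmall y
    _ = ‖a‖ * ε * ‖E y‖ := by ring

theorem SpectralTriple.isFinitePositiveTrace (X : SpectralTriple H) {n : ℝ} (hn : 0 < n)
    (hX : X.anglePow n ∈ dixmierIdeal H) {ρ : (H →L[ℂ] H) → ℂ} (hρ : IsPositiveSingularTrace ρ) :
    IsFinitePositiveTrace X.A (fun a => ρ ((a : H →L[ℂ] H) * X.anglePow n)) := by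
  obtain ⟨φ, hφ⟩ := hρ.exists_functional hX
  simp only [← hφ]
  refine ⟨⟨fun a b => by simp, fun c a => by simp⟩, ⟨‖φ‖, fun a => φ.le_opNorm _⟩, fun a ha => ?_,
    fun a b => ?_⟩
  · rw [hφ]
    exact hρ.apply_mul_nonneg hX (X.anglePow_nonneg n) ha
  · rw [hφ, hφ]
    exact X.apply_mul_comm_anglePow hn hX hρ a b.2

theorem SpectralTriple.isTraceState (X : SpectralTriple H) {n : ℝ} (hn : 0 < n)
    (hX : X.anglePow n ∈ dixmierIdeal H) {ρ : (H →L[ℂ] H) → ℂ} (hρ : IsPositiveSingularTrace ρ)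
    (hpos : 0 < ρ (X.anglePow n)) :
    IsTraceState X.A
      (fun a => (ρ (X.anglePow n))⁻¹ * ρ ((a : H →L[ℂ] H) * X.anglePow n)) := by
  have h := X.isFinitePositiveTrace hn hX hρ
  have hinv : 0 ≤ (ρ (X.anglePow n))⁻¹ := (inv_pos.mpr hpos).le
  have hle : ∀ a : X.A, ‖(ρ (X.anglePow n))⁻¹ * ρ ((a : H →L[ℂ] H) * X.anglePow n)‖ ≤
      ‖(a : H →L[ℂ] H)‖ := by
    intro a
    rw [norm_mul, norm_inv, inv_mul_le_iff₀ (norm_pos_iff.mpr hpos.ne'), mul_comm]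
    exact hρ.norm_apply_mul_le hX (X.anglePow_nonneg n) a
  refine ⟨⟨⟨fun a b => ?_, fun c a => ?_⟩, ⟨1, fun a => by rw [one_mul]; exact hle a⟩, fun a ha =>
    mul_nonneg hinv (h.nonneg a ha), fun a b => ?_⟩, ?_, hle⟩
  · rw [h.isLinearMap.map_add, mul_add]
  · rw [h.isLinearMap.map_smul, smul_eq_mul, smul_eq_mul]
    ring
  · rw [h.map_mul_comm]
  · rw [OneMemClass.coe_one, one_mul, inv_mul_cancel₀ hpos.ne']

end NCG

theorem corollary4p5 {H : Type*} [NormedAddCommGroup H] [InnerProductSpace ℂ H] [CompleteSpace H]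
    [TopologicalSpace.SeparableSpace H] (X : NCG.SpectralTriple H) (n : ℝ) (hn : 0 < n)
    (hX : X.anglePow n ∈ NCG.dixmierIdeal H)
    (ρ : (H →L[ℂ] H) → ℂ) (hρ : NCG.IsPositiveSingularTrace ρ) (hpos : 0 < ρ (X.anglePow n)) :
    (∀ a ∈ X.A, a * X.anglePow n ∈ NCG.dixmierIdeal H) ∧
    NCG.IsFinitePositiveTrace X.A (fun a => ρ ((a : H →L[ℂ] H) * X.anglePow n)) ∧
    NCG.IsTraceState X.A
      (fun a => (ρ (X.anglePow n))⁻¹ * ρ ((a : H →L[ℂ] H) * X.anglePow n)) ∧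
    (ρ (X.anglePow n) = 1 →
      NCG.IsTraceState X.A (fun a => ρ ((a : H →L[ℂ] H) * X.anglePow n))) := by
  have hstate := X.isTraceState hn hX hρ hpos
  refine ⟨fun a _ => NCG.mul_mem_dixmierIdeal hX a, X.isFinitePositiveTrace hn hX hρ, hstate,
    fun h1 => ?_⟩
  simpa only [h1, inv_one, one_mul] using hstate
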